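/- Let $(X,\rho,\mathfrak M,\mu)$ be a space of homogeneous type: $\rho$ is a quasimetric on $X$, i.e. $\rho(x,y)\ge 0$ with equality iff $x=y$, $\rho(x,y)=\rho(y,x)$ and $\rho(x,y)\le D(\rho(x,z)+\rho(z,y))$ for all $x,y,z\in X$ with a constant $D>1$; $\mu$ is a positive measure on a $\sigma$-algebra $\mathfrak M$ that contains all balls $B(x,r)=\{y:\rho(x,y)<r\}$, $0<r<\infty$, and all $\rho$-open sets (sets that contain, with each of their points $x$, some ball $B(x,r)$); and $\mu(B(x,2r))\le H\mu(B(x,r))$ for all $x\in X$, $r>0$. Let $\mathcal U(\rho)$ be the family of all balls. Assume the density condition: for every $E\in\mathfrak M$, almost every $x\in E$ has the property that for every $\varepsilon>0$ there is a ball $B\in\mathcal U(\rho)$ with $x\in B$ and $\mu(B\cap E)>(1-\varepsilon)\mu(B)$. Let $0<\gamma<1$ and let $\mathcal S\subset\mathcal U(\rho)$ be $\gamma$-sparse, i.e. for every $B\in\mathcal S$ there is a measurable set $E_B\subset B$ with $\mu(E_B)\ge\gamma\mu(B)$, the sets $E_B$, $B\in\mathcal S$, being pairwise disjoint. Let $1<p<\infty$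 and let $w$ be a weight (a measurable, a.e. positive function) with $$[w]_{A_p}=\sup_{B\in\mathcal U(\rho)}\left(\frac1{\mu(B)}\int_B w\,d\mu\right)\left(\frac1{\mu(B)}\int_B w^{-1/(p-1)}\,d\mu\right)^{p-1}<\infty .$$ Then the sparse operator $\mathcal A_{\mathcal S}f(x)=\sum_{B\in\mathcal S}\left(\frac1{\mu(B)}\int_B|f|\,d\mu\right)\mathbf 1_B(x)$ satisfies $$\|\mathcal A_{\mathcal S}\|_{L^p(w)\to L^p(w)}\le c\cdot c_p\,[w]_{A_p}^{\max\{1,\,1/(p-1)\}},$$ where $L^p(w)=L^p(X,w\,d\mu)$, the constant $c>0$ depends only on $H$, $D$ and $\gamma$, and the constant $c_p>0$ depends only on $p$. -/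

import Mathlib

open MeasureTheory
open scoped ENNReal

namespace HomogeneousType

variable {X : Type*}

/-- `ρ` is a quasimetric with constant `D` in the relaxed triangle inequality. -/
structure IsQuasimetric (ρ : X → X → ℝ) (D : ℝ) : Prop where
  one_lt : 1 < D
  nonneg : ∀ x y, 0 ≤ ρ x y
  eq_zero_iff : ∀ x y, ρ x y = 0 ↔ x = y
  symm : ∀ x y, ρ x y = ρ y x
  triangle : ∀ x y z, ρ x y ≤ D * (ρ x z + ρ z y)

/-- The ball of center `x` and radius `r`. -/
def qball (ρ : X → X → ℝ) (x : X) (r : ℝ) : Set X := {y | ρ x y < r}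

/-- The family of all balls of positive finite radius. -/
def balls (ρ : X → X → ℝ) : Set (Set X) := {B | ∃ x r, 0 < r ∧ B = qball ρ x r}

/-- Open sets of the topology defined by the quasimetric. -/
def IsQOpen (ρ : X → X → ℝ) (U : Set X) : Prop :=
  ∀ x ∈ U, ∃ r, 0 < r ∧ qball ρ x r ⊆ U

/-- `(X, ρ, μ)` is a space of homogeneous type with quasimetric constant `D` and doubling
constant `H`. Together with the density condition below, the doubling inequality forces
`0 < μ B < ∞` for all balls `B` as soon as `μ ≠ 0`. -/
structure IsSpace [MeasurableSpace X] (ρ : X → X → ℝ) (μ : Measure X) (D H : ℝ) : Prop where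
  quasimetric : IsQuasimetric ρ D
  measurableSet_of_isQOpen : ∀ U, IsQOpen ρ U → MeasurableSet U
  measurableSet_ball : ∀ B ∈ balls ρ, MeasurableSet B
  doubling : ∀ x r, 0 < r → μ (qball ρ x (2 * r)) ≤ ENNReal.ofReal H * μ (qball ρ x r)

/-- `x` is a density point of `E` with respect to the family `𝓑`. -/
def IsDensityPoint [MeasurableSpace X] (μ : Measure X) (𝓑 : Set (Set X)) (E : Set X) (x : X) :
    Prop :=
  ∀ ε : ℝ, 0 < ε → ∃ B ∈ 𝓑, x ∈ B ∧ ENNReal.ofReal (1 - ε) * μ B < μ (B ∩ E)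

/-- Almost all points of any measurable set are density points of this set. -/
def DensityCondition [MeasurableSpace X] (μ : Measure X) (𝓑 : Set (Set X)) : Prop :=
  ∀ E : Set X, MeasurableSet E → ∀ᵐ x ∂μ, x ∈ E → IsDensityPoint μ 𝓑 E x

/-- `S` is a `γ`-sparse collection of sets. -/
def IsSparse [MeasurableSpace X] (μ : Measure X) (γ : ℝ) (S : Set (Set X)) : Prop :=
  ∃ E : Set X → Set X,
    (∀ B ∈ S, MeasurableSet (E B) ∧ E B ⊆ B ∧ ENNReal.ofReal γ * μ B ≤ μ (E B)) ∧
      S.PairwiseDisjoint E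

/-- The operator `f ↦ ∑_{A ∈ S} ⟨f⟩_A 𝟙_A`, where `⟨f⟩_A` is the average of `|f|` over `A`. -/
noncomputable def sparseOperator [MeasurableSpace X] (μ : Measure X) (S : Set (Set X))
    (f : X → ℝ) (x : X) : ℝ≥0∞ :=
  ∑' A : S, (A : Set X).indicator (fun _ => ⨍⁻ y in (A : Set X), ‖f y‖ₑ ∂μ) x

/-- The `A_p` characteristic of the weight `w` with respect to the family `𝓑`. -/
noncomputable def apCharacteristic [MeasurableSpace X] (μ : Measure X) (𝓑 : Set (Set X)) (p : ℝ)
    (w : X → ℝ) : ℝ≥0∞ :=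
  ⨆ B ∈ 𝓑, (⨍⁻ x in B, ENNReal.ofReal (w x) ∂μ) *
    (⨍⁻ x in B, ENNReal.ofReal (w x) ^ (-1 / (p - 1)) ∂μ) ^ (p - 1)

/-- The measure `w dμ`. -/
noncomputable def weightedMeasure [MeasurableSpace X] (μ : Measure X) (w : X → ℝ) : Measure X :=
  μ.withDensity fun x => ENNReal.ofReal (w x)

/-- The norm `‖T‖ = sup_f ‖T f‖_p / ‖f‖_p` of an operator on `L^p(ν)`. Here `0 / 0 = 0`, while
`a / 0 = ∞` for `a ≠ 0`. -/
noncomputable def lpOperatorNorm [MeasurableSpace X] (ν : Measure X) (p : ℝ)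
    (T : (X → ℝ) → X → ℝ≥0∞) : ℝ≥0∞ :=
  ⨆ (f : X → ℝ) (_ : MemLp f (ENNReal.ofReal p) ν),
    eLpNorm (T f) (ENNReal.ofReal p) ν / eLpNorm f (ENNReal.ofReal p) ν

end HomogeneousType

namespace HomogeneousType

open scoped NNReal

/-! Dyadic cubes are replaced by laminar families built from the sparse family itself. By monotone
convergence a finite family suffices. Round the radii to powers of L = 4D² and call two balls
adjacent if they have the same scale t and centers closer than L²t. Doubling and the disjointness of
the sets E_B bound the degrees (`IsSpace.card_neighbors_le`), so boundedly many colors suffice.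
Within a color, smaller sets can be glued to the balls they meet without the radii getting out of
control (`exists_laminar`). This gives nested or disjoint sets Q_B ⊇ B, each inside a ball P with
μ(P) ≤ K μ(E_B).

On a laminar family the maximal operator of any measure obeys Doob's L^p bound, whose constant q =
p/(p-1) does not see the measure. Let σ = w^{-1/(p-1)}, ν = σ dμ, ω = w dμ, and consider Σ μ(B)⁻¹
∫_B F dμ ∫_B g dω with F = hσ. The A_p bound on P and Hölder's inequality on E_B (`inv_mul_mul_le`)
replace ω(Q)ν(Q)/μ(E) by ν(E)^{1/p} ω(E)^{1/q}, for one power of [w]_{A_p} when p ≥ 2. Hölder for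
sums and Doob's bound for ν and for ω finish this case. For p ≤ 2 exchanging the two measures gives
the power 1/(p-1). Testing with g = (A_S f)^{p-1} turns the bilinear bound into the norm bound. -/

/-- Any two of the sets `Q i`, `i ∈ J`, are nested or disjoint. -/
def IsLaminar {ι X : Type*} (J : Finset ι) (Q : ι → Set X) : Prop :=
  ∀ i ∈ J, ∀ j ∈ J, Q i ⊆ Q j ∨ Q j ⊆ Q i ∨ Disjoint (Q i) (Q j)

/-- Divide by I^{1/q} and raise to the power p. This is the absorption step of both Doob's
inequality and the final duality; it needs I finite, so finiteness is proved beforehand each time.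
-/
lemma le_rpow_of_le_mul_rpow {p q : ℝ} (hpq : p.HolderConjugate q) {I a : ℝ≥0∞} (hI : I ≠ ∞)
    (h : I ≤ a * I ^ (1 / q)) : I ≤ a ^ p := by
  have hp := hpq.pos
  by_cases hI0 : I = 0
  · rw [hI0]; exact zero_le
  have hI' : I ^ (1 / p) * I ^ (1 / q) = I := by
    rw [← ENNReal.rpow_add _ _ hI0 hI, one_div, one_div, hpq.inv_add_inv_eq_one, ENNReal.rpow_one]
  have hne : I ^ (1 / q) ≠ 0 := by simp [hI0, hI, hpq.symm.pos]
  have hnt : I ^ (1 / q) ≠ ∞ := ENNReal.rpow_ne_top_of_nonneg hpq.symm.one_div_nonneg hI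
  calc I = (I ^ (1 / p)) ^ p := by
        rw [← ENNReal.rpow_mul, one_div_mul_cancel hp.ne', ENNReal.rpow_one]
    _ ≤ a ^ p := by
        gcongr
        rwa [← ENNReal.mul_le_mul_iff_left hne hnt, hI']

/-! ### Doob's maximal inequality and Carleson embedding on laminar families -/

section Maximal

variable {ι X : Type*} [MeasurableSpace X]

/-- A covering inequality for laminar families passes to the union. -/
lemma IsLaminar.mul_measure_biUnion_le (ν : Measure X) (h : X → ℝ≥0∞) (t : ℝ≥0∞) (Q : ι → Set X)
    (J : Finset ι) (hlam : IsLaminar J Q) (hQ : ∀ i ∈ J, MeasurableSet (Q i))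
    (hJ : ∀ i ∈ J, t * ν (Q i) ≤ ∫⁻ x in Q i, h x ∂ν) :
    t * ν (⋃ i ∈ J, Q i) ≤ ∫⁻ x in ⋃ i ∈ J, Q i, h x ∂ν := by
  classical
  induction J using Finset.strongInduction with
  | H J ih =>
    -- A set contained in another one, possibly equal to it, is discarded without changing the
    -- union. When none is left, laminarity means disjointness and the inequalities add up.
    by_cases hex : ∃ i ∈ J, ∃ j ∈ J, i ≠ j ∧ Q i ⊆ Q j
    · obtain ⟨i, hi, j, hj, hij, hsub⟩ := hex
      have hU : ⋃ k ∈ J, Q k = ⋃ k ∈ J.erase i, Q k := by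
        apply Set.Subset.antisymm
        · refine Set.iUnion₂_subset fun k hk => ?_
          by_cases hki : k = i
          · subst hki
            exact hsub.trans (Set.subset_biUnion_of_mem (u := Q)
              (show j ∈ ((J.erase k : Finset ι) : Set ι) by simp [hj, hij.symm]))
          · exact Set.subset_biUnion_of_mem (u := Q)
              (show k ∈ ((J.erase i : Finset ι) : Set ι) by simp [hk, hki])
        · exact Set.biUnion_subset_biUnion_left fun k hk => Finset.mem_of_mem_erase hk
      rw [hU]
      exact ih _ (Finset.erase_ssubset hi)
        (fun a ha b hb => hlam a (Finset.mem_of_mem_erase ha) b (Finset.mem_of_mem_erase hb))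
        (fun a ha => hQ a (Finset.mem_of_mem_erase ha))
        (fun a ha => hJ a (Finset.mem_of_mem_erase ha))
    · push Not at hex
      have hd : Set.PairwiseDisjoint (J : Set ι) Q := by
        intro i hi j hj hij
        rcases hlam i hi j hj with h1 | h1 | h1
        · exact absurd h1 (hex i hi j hj hij)
        · exact absurd h1 (hex j hj i hi hij.symm)
        · exact h1
      rw [measure_biUnion_finset hd hQ, lintegral_biUnion_finset hd hQ, Finset.mul_sum]
      exact Finset.sum_le_sum hJ

/-- Doob's passage from a sharp weak type inequality to the strong one. -/
lemma lintegral_rpow_le_of_weak_type (ν : Measure X) {p q : ℝ} (hpq : p.HolderConjugate q)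
    (h : X → ℝ≥0∞) (hh : Measurable h) (M : X → ℝ≥0) (hM : Measurable M)
    (hfin : ∫⁻ x, (M x : ℝ≥0∞) ^ p ∂ν ≠ ∞)
    (hweak : ∀ t : ℝ, 0 < t →
      ENNReal.ofReal t * ν {x | t < M x} ≤ ∫⁻ x in {x | t < M x}, h x ∂ν) :
    ∫⁻ x, (M x : ℝ≥0∞) ^ p ∂ν ≤ ENNReal.ofReal q ^ p * ∫⁻ x, h x ^ p ∂ν := by
  have hp := hpq.pos
  have hp1 := hpq.sub_one_pos
  have hMr : Measurable fun x => (M x : ℝ) := by fun_prop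
  have conv : ∀ (s : ℝ) (_ : 0 < s) (x : X),
      ENNReal.ofReal ((M x : ℝ) ^ s) = (M x : ℝ≥0∞) ^ s := by
    intro s hs x
    rw [← ENNReal.ofReal_rpow_of_nonneg (M x).coe_nonneg hs.le, ENNReal.ofReal_coe_nnreal]
  -- Integrate the weak type inequality against p t^{p-2} dt. The right side is a layer cake formula
  -- for the measure h dν with exponent p - 1, and p = q(p - 1) produces the factor q.
  have key : ∫⁻ x, (M x : ℝ≥0∞) ^ p ∂ν ≤
      ENNReal.ofReal q * ∫⁻ x, h x * (M x : ℝ≥0∞) ^ (p - 1) ∂ν := by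
    have e1 := lintegral_rpow_eq_lintegral_meas_lt_mul ν (f := fun x => (M x : ℝ))
      (Filter.Eventually.of_forall fun x => (M x).coe_nonneg) hMr.aemeasurable hp
    have e2 := lintegral_rpow_eq_lintegral_meas_lt_mul (ν.withDensity h) (f := fun x => (M x : ℝ))
      (Filter.Eventually.of_forall fun x => (M x).coe_nonneg) hMr.aemeasurable hp1
    simp only [conv p hp, conv (p - 1) hp1] at e1 e2
    rw [lintegral_withDensity_eq_lintegral_mul _ hh (by fun_prop)] at e2
    simp only [Pi.mul_apply] at e2
    rw [e1, e2, ← mul_assoc, ← ENNReal.ofReal_mul hpq.symm.nonneg,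
      show q * (p - 1) = p by rw [mul_comm]; exact hpq.sub_one_mul_conj]
    gcongr ENNReal.ofReal p * ?_
    refine setLIntegral_mono' measurableSet_Ioi fun t ht => ?_
    have ht0 : (0 : ℝ) < t := ht
    rw [withDensity_apply _ (measurableSet_lt measurable_const hMr)]
    calc ν {a | t < M a} * ENNReal.ofReal (t ^ (p - 1))
        = (ENNReal.ofReal t * ν {x | t < M x}) * ENNReal.ofReal (t ^ (p - 1 - 1)) := by
          rw [mul_comm (ENNReal.ofReal t), mul_assoc, ← ENNReal.ofReal_mul ht0.le]
          congr 2
          rw [← Real.rpow_one_add' ht0.le (by linarith)]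
          congr 1; ring
      _ ≤ _ := by gcongr; exact hweak t ht0
  set I := ∫⁻ x, (M x : ℝ≥0∞) ^ p ∂ν with hI
  have hold := ENNReal.lintegral_mul_le_Lp_mul_Lq ν hpq hh.aemeasurable
    (g := fun x => (M x : ℝ≥0∞) ^ (p - 1)) (by fun_prop)
  simp only [Pi.mul_apply, ← ENNReal.rpow_mul, hpq.sub_one_mul_conj] at hold
  rw [← hI] at hold
  calc I ≤ (ENNReal.ofReal q * (∫⁻ x, h x ^ p ∂ν) ^ (1 / p)) ^ p := by
        refine le_rpow_of_le_mul_rpow hpq hfin (key.trans ?_)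
        rw [mul_assoc]
        gcongr
    _ = _ := by
        rw [ENNReal.mul_rpow_of_nonneg _ _ hp.le, ← ENNReal.rpow_mul, one_div_mul_cancel hp.ne',
          ENNReal.rpow_one]

/-- The Carleson embedding for disjoint parts of a laminar family. -/
lemma IsLaminar.sum_laverage_rpow_mul_le (ν : Measure X) {p q : ℝ} (hpq : p.HolderConjugate q)
    (h : X → ℝ≥0∞) (hh : Measurable h) (Q E : ι → Set X) (J : Finset ι)
    (hlam : IsLaminar J Q) (hQ : ∀ i ∈ J, MeasurableSet (Q i))
    (hE : ∀ i ∈ J, MeasurableSet (E i)) (hEQ : ∀ i ∈ J, E i ⊆ Q i)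
    (hdisj : Set.PairwiseDisjoint (J : Set ι) E)
    (h0 : ∀ i ∈ J, ν (Q i) ≠ 0) (htop : ∀ i ∈ J, ν (Q i) ≠ ∞) :
    ∑ i ∈ J, ((ν (Q i))⁻¹ * ∫⁻ x in Q i, h x ∂ν) ^ p * ν (E i) ≤
      ENNReal.ofReal q ^ p * ∫⁻ x, h x ^ p ∂ν := by
  classical
  have hp := hpq.pos
  by_cases hfin : ∫⁻ x, h x ^ p ∂ν = ∞
  · rw [hfin, ENNReal.mul_top]
    · exact le_top
    · simp [hp, hpq.symm.pos]
  have hint : ∀ i ∈ J, ∫⁻ x in Q i, h x ∂ν ≠ ∞ := by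
    intro i hi
    have := ENNReal.lintegral_mul_le_Lp_mul_Lq (ν.restrict (Q i)) hpq hh.aemeasurable
      (g := fun _ => 1) (by fun_prop)
    simp only [Pi.mul_apply, mul_one, ENNReal.one_rpow, lintegral_const, one_mul,
      Measure.restrict_apply_univ] at this
    refine ne_top_of_le_ne_top (ENNReal.mul_ne_top ?_ ?_) this
    · exact ENNReal.rpow_ne_top_of_nonneg hpq.one_div_nonneg
        (ne_top_of_le_ne_top hfin (setLIntegral_le_lintegral _ _))
    · exact ENNReal.rpow_ne_top_of_nonneg hpq.symm.one_div_nonneg (htop i hi)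
  have hav : ∀ i ∈ J, (ν (Q i))⁻¹ * ∫⁻ x in Q i, h x ∂ν ≠ ∞ := fun i hi =>
    ENNReal.mul_ne_top (ENNReal.inv_ne_top.2 (h0 i hi)) (hint i hi)
  let c : ι → ℝ≥0 := fun i => ((ν (Q i))⁻¹ * ∫⁻ x in Q i, h x ∂ν).toNNReal
  have hc : ∀ i ∈ J, (c i : ℝ≥0∞) = (ν (Q i))⁻¹ * ∫⁻ x in Q i, h x ∂ν := fun i hi =>
    ENNReal.coe_toNNReal (hav i hi)
  -- The maximal function of the family. It dominates the i-th average on E i, and its superlevel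
  -- sets are unions of subfamilies, which are again laminar.
  let M : X → ℝ≥0 := fun x => J.sup fun i => (Q i).indicator (fun _ => c i) x
  have hM : Measurable M := by
    have : M = J.sup fun i => (Q i).indicator fun _ => c i := by
      ext x
      simp [M, Finset.sup_apply]
    rw [this]
    exact Finset.sup_induction (p := Measurable) measurable_const (fun a ha b hb => ha.sup hb)
      fun i hi => measurable_const.indicator (hQ i hi)
  have hcM : ∀ i ∈ J, ∀ x ∈ Q i, c i ≤ M x := by
    intro i hi x hx
    have := Finset.le_sup (f := fun i => (Q i).indicator (fun _ => c i) x) hi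
    simpa [hx] using this
  have hlev : ∀ t : ℝ, 0 < t →
      {x | t < M x} = ⋃ i ∈ J.filter (fun i => t < c i), Q i := by
    intro t ht
    lift t to ℝ≥0 using ht.le
    ext x
    simp only [Set.mem_ofPred_eq, NNReal.coe_lt_coe, Finset.mem_filter, Set.mem_iUnion, exists_prop]
    constructor
    · intro hx
      obtain ⟨i, hi, hlt⟩ := Finset.lt_sup_iff.1 hx
      by_cases hxi : x ∈ Q i
      · exact ⟨i, ⟨hi, by simpa [hxi] using hlt⟩, hxi⟩
      · simp [hxi] at hlt
    · rintro ⟨i, ⟨hi, hlt⟩, hx⟩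
      exact hlt.trans_le (hcM i hi x hx)
  have hMfin : ∫⁻ x, (M x : ℝ≥0∞) ^ p ∂ν ≠ ∞ := by
    have hle : ∀ x, (M x : ℝ≥0∞) ^ p ≤
        ∑ i ∈ J, (Q i).indicator (fun _ => (c i : ℝ≥0∞) ^ p) x := by
      intro x
      by_cases hJ : J.Nonempty
      · obtain ⟨i, hi, hix⟩ := Finset.exists_mem_eq_sup J hJ
          fun i => (Q i).indicator (fun _ => c i) x
        have : (M x : ℝ≥0∞) ^ p = (Q i).indicator (fun _ => (c i : ℝ≥0∞) ^ p) x := by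
          change ((J.sup _ : ℝ≥0) : ℝ≥0∞) ^ p = _
          rw [hix]
          by_cases hxi : x ∈ Q i <;> simp [hxi, hp]
        rw [this]
        exact Finset.single_le_sum (f := fun i => (Q i).indicator (fun _ => (c i : ℝ≥0∞) ^ p) x)
          (fun _ _ => zero_le) hi
      · rw [Finset.not_nonempty_iff_eq_empty] at hJ
        subst hJ
        simp [M, hp]
    refine ne_top_of_le_ne_top ?_ (lintegral_mono hle)
    rw [lintegral_finsetSum' _ fun i hi => (measurable_const.indicator (hQ i hi)).aemeasurable]
    refine (ENNReal.sum_lt_top.2 fun i hi => ?_).ne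
    rw [lintegral_indicator_const (hQ i hi)]
    exact ENNReal.mul_lt_top (ENNReal.rpow_lt_top_of_nonneg hp.le ENNReal.coe_ne_top)
      (htop i hi).lt_top
  have hweak : ∀ t : ℝ, 0 < t →
      ENNReal.ofReal t * ν {x | t < M x} ≤ ∫⁻ x in {x | t < M x}, h x ∂ν := by
    intro t ht
    rw [hlev t ht]
    refine IsLaminar.mul_measure_biUnion_le ν h _ Q _ ?_ ?_ ?_
    · exact fun i hi j hj => hlam i (Finset.mem_of_mem_filter i hi) j (Finset.mem_of_mem_filter j hj)
    · exact fun i hi => hQ i (Finset.mem_of_mem_filter i hi)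
    · intro i hi
      obtain ⟨hiJ, hti⟩ := Finset.mem_filter.1 hi
      have : ENNReal.ofReal t ≤ c i := by
        rw [← ENNReal.ofReal_coe_nnreal]
        exact ENNReal.ofReal_le_ofReal hti.le
      calc ENNReal.ofReal t * ν (Q i) ≤ c i * ν (Q i) := by gcongr
        _ = ∫⁻ x in Q i, h x ∂ν := by
          rw [hc i hiJ, mul_comm, ← mul_assoc, ENNReal.mul_inv_cancel (h0 i hiJ) (htop i hiJ),
            one_mul]
  calc ∑ i ∈ J, ((ν (Q i))⁻¹ * ∫⁻ x in Q i, h x ∂ν) ^ p * ν (E i)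
      ≤ ∑ i ∈ J, ∫⁻ x in E i, (M x : ℝ≥0∞) ^ p ∂ν := by
        refine Finset.sum_le_sum fun i hi => ?_
        rw [← hc i hi, ← setLIntegral_const]
        refine setLIntegral_mono' (hE i hi) fun x hx => ?_
        have := hcM i hi x (hEQ i hi hx)
        gcongr
    _ = ∫⁻ x in ⋃ i ∈ J, E i, (M x : ℝ≥0∞) ^ p ∂ν := (lintegral_biUnion_finset hdisj hE _).symm
    _ ≤ ∫⁻ x, (M x : ℝ≥0∞) ^ p ∂ν := setLIntegral_le_lintegral _ _
    _ ≤ _ := lintegral_rpow_le_of_weak_type ν hpq h hh M hM hMfin hweak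

end Maximal

/-! ### Sharp bilinear estimate on a laminar family -/

section Bilinear

/-- The elementary inequality behind the sharp exponent. -/
lemma inv_mul_mul_le {p q : ℝ} (hpq : p.HolderConjugate q) (hp2 : 2 ≤ p)
    {a b m e s A : ℝ≥0∞} (hm0 : m ≠ 0) (hm : m ≠ ∞) (hb : b ≠ ∞) (hsb : s ≤ b)
    (hA : a * b ^ (p - 1) ≤ A * m ^ p) (hmes : m ≤ e ^ (1 / p) * s ^ (1 / q)) :
    m⁻¹ * (a * b) ≤ A * (s ^ (1 / p) * e ^ (1 / q)) := by
  have hp := hpq.pos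
  have hq := hpq.symm.pos
  have hs0 : s ≠ 0 := by
    rintro rfl
    rw [ENNReal.zero_rpow_of_pos (by positivity), mul_zero] at hmes
    exact hm0 (le_antisymm hmes zero_le)
  have hs : s ≠ ∞ := ne_top_of_le_ne_top hb hsb
  have hb0 : b ≠ 0 := fun h => hs0 (le_antisymm (h ▸ hsb) zero_le)
  -- In use a = ω(Q), b = ν(Q), m = μ(E), e = ω(E), s = ν(E). As 2 - p ≤ 0, the excess power b^{2-p}
  -- is at most s^{2-p}; this is where p ≥ 2 enters.
  calc m⁻¹ * (a * b) = m⁻¹ * ((a * b ^ (p - 1)) * b ^ (2 - p)) := by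
        rw [mul_assoc a, ← ENNReal.rpow_add _ _ hb0 hb, show p - 1 + (2 - p) = 1 by ring,
          ENNReal.rpow_one]
    _ ≤ m⁻¹ * ((A * m ^ p) * s ^ (2 - p)) := by
        gcongr m⁻¹ * (?_ * ?_)
        rw [← neg_sub p 2, ENNReal.rpow_neg, ENNReal.rpow_neg, ENNReal.inv_le_inv]
        exact ENNReal.rpow_le_rpow hsb (by linarith)
    _ = A * (m ^ (p - 1) * s ^ (2 - p)) := by
        rw [ENNReal.rpow_sub _ _ hm0 hm, ENNReal.rpow_one, ENNReal.div_eq_inv_mul]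
        ring
    _ ≤ A * ((e ^ (1 / p) * s ^ (1 / q)) ^ (p - 1) * s ^ (2 - p)) := by
        have := hpq.sub_one_pos
        gcongr
    _ = A * (s ^ (1 / p) * e ^ (1 / q)) := by
        have hq' : 1 / q = 1 - 1 / p := by rw [one_div, one_div]; exact hpq.one_sub_inv.symm
        rw [ENNReal.mul_rpow_of_nonneg _ _ hpq.sub_one_pos.le, ← ENNReal.rpow_mul,
          ← ENNReal.rpow_mul, mul_assoc, ← ENNReal.rpow_add _ _ hs0 hs, mul_comm (s ^ (1 / p)),
          hq']
        congr 3
        · field_simp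
        · field_simp; ring

variable {ι X : Type*} [MeasurableSpace X]

/-- The bilinear form of a sparse operator with respect to a laminar family, `2 ≤ p`. -/
lemma IsLaminar.sum_bilinear_le (ν ω : Measure X) {p q : ℝ} (hpq : p.HolderConjugate q)
    (hp2 : 2 ≤ p) (h g : X → ℝ≥0∞) (hh : Measurable h) (hg : Measurable g)
    (Q E : ι → Set X) (m : ι → ℝ≥0∞) (A : ℝ≥0∞) (J : Finset ι)
    (hlam : IsLaminar J Q) (hQ : ∀ i ∈ J, MeasurableSet (Q i))
    (hE : ∀ i ∈ J, MeasurableSet (E i)) (hEQ : ∀ i ∈ J, E i ⊆ Q i)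
    (hdisj : Set.PairwiseDisjoint (J : Set ι) E)
    (hν0 : ∀ i ∈ J, ν (Q i) ≠ 0) (hν : ∀ i ∈ J, ν (Q i) ≠ ∞)
    (hω0 : ∀ i ∈ J, ω (Q i) ≠ 0) (hω : ∀ i ∈ J, ω (Q i) ≠ ∞)
    (hm0 : ∀ i ∈ J, m i ≠ 0) (hm : ∀ i ∈ J, m i ≠ ∞)
    (hA : ∀ i ∈ J, ω (Q i) * ν (Q i) ^ (p - 1) ≤ A * m i ^ p)
    (hmE : ∀ i ∈ J, m i ≤ ω (E i) ^ (1 / p) * ν (E i) ^ (1 / q)) :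
    ∑ i ∈ J, (m i)⁻¹ * ((∫⁻ x in Q i, h x ∂ν) * ∫⁻ x in Q i, g x ∂ω) ≤
      A * (ENNReal.ofReal p * ENNReal.ofReal q) *
        ((∫⁻ x, h x ^ p ∂ν) ^ (1 / p) * (∫⁻ x, g x ^ q ∂ω) ^ (1 / q)) := by
  have hp := hpq.pos
  have hq := hpq.symm.pos
  set a : ι → ℝ≥0∞ := fun i => (ν (Q i))⁻¹ * ∫⁻ x in Q i, h x ∂ν with ha
  set b : ι → ℝ≥0∞ := fun i => (ω (Q i))⁻¹ * ∫⁻ x in Q i, g x ∂ω with hb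
  calc ∑ i ∈ J, (m i)⁻¹ * ((∫⁻ x in Q i, h x ∂ν) * ∫⁻ x in Q i, g x ∂ω)
      -- Each factor is an average times a power of the measure of the disjoint part, the form
      -- required by the Carleson embedding: exponent p for ν, exponent q for ω.
      ≤ ∑ i ∈ J, A * ((a i * ν (E i) ^ (1 / p)) * (b i * ω (E i) ^ (1 / q))) := by
        refine Finset.sum_le_sum fun i hi => ?_
        have e1 : ∫⁻ x in Q i, h x ∂ν = ν (Q i) * a i := by
          rw [ha, ← mul_assoc, ENNReal.mul_inv_cancel (hν0 i hi) (hν i hi), one_mul]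
        have e2 : ∫⁻ x in Q i, g x ∂ω = ω (Q i) * b i := by
          rw [hb, ← mul_assoc, ENNReal.mul_inv_cancel (hω0 i hi) (hω i hi), one_mul]
        have key := inv_mul_mul_le hpq hp2 (hm0 i hi) (hm i hi) (hν i hi)
          (measure_mono (hEQ i hi))
          (hA i hi) (hmE i hi)
        rw [e1, e2]
        calc (m i)⁻¹ * (ν (Q i) * a i * (ω (Q i) * b i))
            = ((m i)⁻¹ * (ω (Q i) * ν (Q i))) * (a i * b i) := by ring
          _ ≤ (A * (ν (E i) ^ (1 / p) * ω (E i) ^ (1 / q))) * (a i * b i) := by gcongr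
          _ = _ := by ring
    _ = A * ∑ i ∈ J, (a i * ν (E i) ^ (1 / p)) * (b i * ω (E i) ^ (1 / q)) := by
        rw [Finset.mul_sum]
    _ ≤ A * ((∑ i ∈ J, (a i * ν (E i) ^ (1 / p)) ^ p) ^ (1 / p) *
          (∑ i ∈ J, (b i * ω (E i) ^ (1 / q)) ^ q) ^ (1 / q)) := by
        gcongr
        exact ENNReal.inner_le_Lp_mul_Lq _ _ _ hpq
    _ = A * ((∑ i ∈ J, a i ^ p * ν (E i)) ^ (1 / p) *
          (∑ i ∈ J, b i ^ q * ω (E i)) ^ (1 / q)) := by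
        simp only [ENNReal.mul_rpow_of_nonneg _ _ hp.le, ENNReal.mul_rpow_of_nonneg _ _ hq.le,
          ← ENNReal.rpow_mul, one_div_mul_cancel hp.ne', one_div_mul_cancel hq.ne',
          ENNReal.rpow_one]
    _ ≤ A * ((ENNReal.ofReal q ^ p * ∫⁻ x, h x ^ p ∂ν) ^ (1 / p) *
          (ENNReal.ofReal p ^ q * ∫⁻ x, g x ^ q ∂ω) ^ (1 / q)) := by
        gcongr
        · exact hlam.sum_laverage_rpow_mul_le ν hpq h hh Q E J hQ hE hEQ hdisj hν0 hν
        · exact hlam.sum_laverage_rpow_mul_le ω hpq.symm g hg Q E J hQ hE hEQ hdisj hω0 hω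
    _ = _ := by
        rw [ENNReal.mul_rpow_of_nonneg _ _ (by positivity),
          ENNReal.mul_rpow_of_nonneg _ _ (by positivity), ← ENNReal.rpow_mul, ← ENNReal.rpow_mul,
          mul_one_div_cancel hp.ne', mul_one_div_cancel hq.ne', ENNReal.rpow_one, ENNReal.rpow_one]
        ring

/-- The bilinear form of a sparse operator with respect to a laminar family. -/
lemma IsLaminar.sum_bilinear_le_max (ν ω : Measure X) {p q : ℝ} (hpq : p.HolderConjugate q)
    (h g : X → ℝ≥0∞) (hh : Measurable h) (hg : Measurable g)
    (Q E : ι → Set X) (m : ι → ℝ≥0∞) (A K : ℝ≥0∞) (J : Finset ι)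
    (hlam : IsLaminar J Q) (hQ : ∀ i ∈ J, MeasurableSet (Q i))
    (hE : ∀ i ∈ J, MeasurableSet (E i)) (hEQ : ∀ i ∈ J, E i ⊆ Q i)
    (hdisj : Set.PairwiseDisjoint (J : Set ι) E)
    (hν0 : ∀ i ∈ J, ν (Q i) ≠ 0) (hν : ∀ i ∈ J, ν (Q i) ≠ ∞)
    (hω0 : ∀ i ∈ J, ω (Q i) ≠ 0) (hω : ∀ i ∈ J, ω (Q i) ≠ ∞)
    (hm0 : ∀ i ∈ J, m i ≠ 0) (hm : ∀ i ∈ J, m i ≠ ∞)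
    (hA : ∀ i ∈ J, ω (Q i) * ν (Q i) ^ (p - 1) ≤ A * (K * m i) ^ p)
    (hmE : ∀ i ∈ J, m i ≤ ω (E i) ^ (1 / p) * ν (E i) ^ (1 / q)) :
    ∑ i ∈ J, (m i)⁻¹ * ((∫⁻ x in Q i, h x ∂ν) * ∫⁻ x in Q i, g x ∂ω) ≤
      A ^ max 1 (1 / (p - 1)) * K ^ max p q * (ENNReal.ofReal p * ENNReal.ofReal q) *
        ((∫⁻ x, h x ^ p ∂ν) ^ (1 / p) * (∫⁻ x, g x ^ q ∂ω) ^ (1 / q)) := by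
  have hp := hpq.pos
  have hp1 := hpq.sub_one_pos
  have hq := hpq.symm.pos
  have hqp : q = p / (p - 1) := hpq.conjugate_eq
  rcases le_total 2 p with hp2 | hp2
  · rw [max_eq_left ((div_le_one hp1).2 (by linarith)), ENNReal.rpow_one,
      max_eq_left (show q ≤ p by rw [hqp, div_le_iff₀ hp1]; nlinarith)]
    refine hlam.sum_bilinear_le ν ω hpq hp2 h g hh hg Q E m _ J hQ hE hEQ hdisj
      hν0 hν hω0 hω hm0 hm (fun i hi => ?_) hmE
    rw [mul_assoc, ← ENNReal.mul_rpow_of_nonneg _ _ hp.le]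
    exact hA i hi
  · rw [max_eq_right ((one_le_div hp1).2 (by linarith)),
      max_eq_right (show p ≤ q by rw [hqp, le_div_iff₀ hp1]; nlinarith)]
    have hq2 : 2 ≤ q := by rw [hqp, le_div_iff₀ hp1]; linarith
    have hq1 : q - 1 = 1 / (p - 1) := by rw [hqp]; field_simp; ring
    -- For p ≤ 2 exchange (ν, h, p) and (ω, g, q). The hypothesis `hA` raised to the power 1/(p-1) =
    -- q - 1 is the same condition for the swapped pair, with constant A^{1/(p-1)} K^q.
    have := hlam.sum_bilinear_le ω ν hpq.symm hq2 g h hg hh Q E m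
      (A ^ (1 / (p - 1)) * K ^ q) J hQ hE hEQ hdisj hω0 hω hν0 hν hm0 hm (fun i hi => ?_)
      (fun i hi => (hmE i hi).trans_eq (mul_comm _ _))
    · rw [mul_comm (ENNReal.ofReal p), mul_comm ((∫⁻ x, h x ^ p ∂ν) ^ (1 / p))]
      simpa only [mul_comm (∫⁻ x in Q _, h x ∂ν)] using this
    · have h1 := ENNReal.rpow_le_rpow (hA i hi) (show 0 ≤ 1 / (p - 1) by positivity)
      rw [ENNReal.mul_rpow_of_nonneg _ _ (by positivity),
        ENNReal.mul_rpow_of_nonneg _ _ (by positivity), ← ENNReal.rpow_mul, ← ENNReal.rpow_mul,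
        mul_one_div_cancel hp1.ne', ENNReal.rpow_one, mul_one_div, ← hqp] at h1
      rw [hq1, mul_assoc, ← ENNReal.mul_rpow_of_nonneg _ _ hq.le, mul_comm]
      exact h1

end Bilinear

/-! ### Greedy coloring -/

section Coloring

variable {ι : Type*}

/-- Greedy coloring of a finite graph. -/
lemma exists_coloring [DecidableEq ι] (R : ι → ι → Prop) [DecidableRel R] (hsymm : ∀ i j, R i j → R j i)
    (hrefl : ∀ i, R i i) (n : ℕ) (J : Finset ι) (hJ : ∀ i ∈ J, (J.filter (R i)).card ≤ n) :
    ∃ col : ι → ℕ, (∀ i ∈ J, col i < n) ∧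
      ∀ i ∈ J, ∀ j ∈ J, i ≠ j → R i j → col i ≠ col j := by
  induction J using Finset.induction_on with
  | empty => exact ⟨fun _ => 0, by simp, by simp⟩
  | insert a J ha ih =>
    obtain ⟨col, hlt, hne⟩ := ih fun i hi =>
      (Finset.card_le_card (Finset.filter_subset_filter _ (Finset.subset_insert a J))).trans
        (hJ i (Finset.mem_insert_of_mem hi))
    -- By reflexivity a counts among its own n neighbors, so fewer than n colors are forbidden.
    have hcard : ((J.filter (R a)).image col).card < (Finset.range n).card := by
      refine Finset.card_image_le.trans_lt ?_
      have := hJ a (Finset.mem_insert_self a J)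
      rw [Finset.filter_insert, if_pos (hrefl a), Finset.card_insert_of_notMem (by simp [ha])] at this
      simpa using this
    obtain ⟨c, hc, hc'⟩ := Finset.exists_mem_notMem_of_card_lt_card hcard
    simp only [Finset.mem_image, Finset.mem_filter, not_exists, not_and, and_imp] at hc'
    have hJa : ∀ i ∈ J, i ≠ a := fun i hi h => ha (h ▸ hi)
    refine ⟨Function.update col a c, ?_, ?_⟩
    · intro i hi
      rcases Finset.mem_insert.1 hi with rfl | hi
      · simpa using hc
      · simpa [hJa i hi] using hlt i hi
    · intro i hi j hj hij hR
      rcases Finset.mem_insert.1 hi with rfl | hi' <;> rcases Finset.mem_insert.1 hj with rfl | hj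
      · exact absurd rfl hij
      · simpa [hJa j hj] using fun h => hc' j hj hR h.symm
      · simpa [hJa i hi'] using hc' i hi' (hsymm _ _ hR)
      · simpa [hJa i hi', hJa j hj] using hne i hi' j hj hij hR

end Coloring

/-! ### Laminar families from sparse families of balls -/

section Geometry

variable {ι X : Type*} {ρ : X → X → ℝ} {D H : ℝ}

lemma qball_mono (x : X) {r s : ℝ} (h : r ≤ s) : qball ρ x r ⊆ qball ρ x s :=
  fun _ hy => lt_of_lt_of_le hy h

lemma mem_qball {x y : X} {r : ℝ} : y ∈ qball ρ x r ↔ ρ x y < r := Iff.rfl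

lemma IsQuasimetric.qball_subset (hρ : IsQuasimetric ρ D) {x y : X} {r s t : ℝ}
    (hxy : ρ y x ≤ t) (h : D * (t + r) ≤ s) : qball ρ x r ⊆ qball ρ y s := by
  intro z hz
  have h1 := hρ.triangle y z x
  have hz' : ρ x z < r := hz
  have h2 : D * (ρ y x + ρ x z) < D * (t + r) :=
    mul_lt_mul_of_pos_left (by linarith) (by linarith [hρ.one_lt])
  exact mem_qball.2 (by linarith)

/-- A finite family of sets which are well separated at each scale is dominated by a laminar
family of comparable sets. -/
lemma exists_laminar [MeasurableSpace X] (hρ : IsQuasimetric ρ D) (J : Finset ι) (x : ι → X)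
    (t : ι → ℝ) (b : ι → Set X) (ht : ∀ i ∈ J, 0 < t i) (hb : ∀ i ∈ J, MeasurableSet (b i))
    (hbx : ∀ i ∈ J, b i ⊆ qball ρ (x i) (4 * D ^ 2 * t i))
    (hgap : ∀ i ∈ J, ∀ j ∈ J, t i < t j → 4 * D ^ 2 * t i ≤ t j)
    (hsep : ∀ i ∈ J, ∀ j ∈ J, i ≠ j → t i = t j → (4 * D ^ 2) ^ 2 * t i ≤ ρ (x i) (x j)) :
    ∃ Q : ι → Set X, IsLaminar J Q ∧ ∀ i ∈ J, MeasurableSet (Q i) ∧ b i ⊆ Q i ∧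
      Q i ⊆ qball ρ (x i) (2 * D * (4 * D ^ 2 * t i)) := by
  classical
  have hD := hρ.one_lt
  induction J using Finset.induction_on_max_value t with
  | empty => exact ⟨fun _ => ∅, by simp [IsLaminar], by simp⟩
  | insert a J ha hmax ih =>
    have hmem : ∀ i ∈ J, i ∈ insert a J := fun i hi => Finset.mem_insert_of_mem hi
    have haa := Finset.mem_insert_self a J
    obtain ⟨Q, hlam, hQ⟩ := ih (fun i hi => ht i (hmem i hi)) (fun i hi => hb i (hmem i hi))
      (fun i hi => hbx i (hmem i hi)) (fun i hi j hj => hgap i (hmem i hi) j (hmem j hj))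
      (fun i hi j hj => hsep i (hmem i hi) j (hmem j hj))
    have hJa : ∀ i ∈ J, i ≠ a := fun i hi h => ha (h ▸ hi)
    -- Sets are inserted by increasing scale; the new one absorbs every set of strictly smaller
    -- scale that meets b a.
    set F := J.filter fun j => t j < t a ∧ (Q j ∩ b a).Nonempty with hF
    set P : Set X := b a ∪ ⋃ j ∈ F, Q j with hP
    have hFJ : ∀ j ∈ F, j ∈ J := fun j hj => Finset.mem_of_mem_filter j hj
    have hFP : ∀ j ∈ F, Q j ⊆ P := fun j hj =>
      (Set.subset_biUnion_of_mem (u := Q) (show j ∈ (F : Set ι) from hj)).trans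
        Set.subset_union_right
    have hta := ht a haa
    -- Since 4D² t j ≤ t a, an absorbed set lies within 2D t a of its center. Attaching it therefore
    -- reaches radius D(4D² t a + 4D² t a) only: the bound reproduces itself and does not
    -- accumulate.
    have hPball : P ⊆ qball ρ (x a) (2 * D * (4 * D ^ 2 * t a)) := by
      have h4 : 0 < 4 * D ^ 2 * t a := by positivity
      refine Set.union_subset ((hbx a haa).trans (qball_mono _ (by nlinarith))) ?_
      refine Set.iUnion₂_subset fun j hj y hy => ?_
      obtain ⟨hjJ, hjt, z, hzQ, hzb⟩ := Finset.mem_filter.1 hj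
      have h1 := (hQ j hjJ).2.2 hzQ
      have h2 := (hQ j hjJ).2.2 hy
      have h3 := hbx a haa hzb
      rw [mem_qball] at h1 h2 h3 ⊢
      have h5 := hgap j (hmem j hjJ) a haa hjt
      have h6 := hρ.triangle (x a) y z
      have h7 := hρ.triangle z y (x j)
      rw [hρ.symm z (x j)] at h7
      have h8 : ρ z y ≤ D * (2 * (2 * D * t a)) := by
        refine h7.trans (mul_le_mul_of_nonneg_left ?_ (by linarith))
        nlinarith
      calc ρ (x a) y ≤ D * (ρ (x a) z + ρ z y) := h6
        _ < D * (4 * D ^ 2 * t a + D * (2 * (2 * D * t a))) :=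
          mul_lt_mul_of_pos_left (by linarith) (by linarith)
        _ = _ := by ring
    have hdis : ∀ j ∈ J, Q j ⊆ P ∨ Disjoint (Q j) P := by
      intro j hj
      rcases (hmax j hj).lt_or_eq with hlt | heq
      · rw [or_iff_not_imp_right]
        intro hnd
        obtain ⟨y, hyj, hyP⟩ := Set.not_disjoint_iff.1 hnd
        rcases hyP with hyb | hyU
        · exact hFP j (Finset.mem_filter.2 ⟨hj, hlt, y, hyj, hyb⟩)
        -- If Q j meets an absorbed Q l, then either Q j ⊆ Q l, or Q l ⊆ Q j and Q j also meets b a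
        -- and is itself absorbed.
        · obtain ⟨l, hl, hyl⟩ := Set.mem_iUnion₂.1 hyU
          rcases hlam j hj l (hFJ l hl) with h | h | h
          · exact h.trans (hFP l hl)
          · obtain ⟨-, -, z, hz, hzb⟩ := Finset.mem_filter.1 hl
            exact hFP j (Finset.mem_filter.2 ⟨hj, hlt, z, h hz, hzb⟩)
          · exact absurd hyl (Set.disjoint_left.1 h hyj)
      -- At equal scale, a common point would put the centers closer than D · 2 · 2D · 4D² t =
      -- (4D²)² t, which is exactly the separation assumed.
      · right
        rw [Set.disjoint_left]
        intro y hyj hyP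
        have h1 := (hQ j hj).2.2 hyj
        have h2 := hPball hyP
        rw [mem_qball] at h1 h2
        have h3 := hsep j (hmem j hj) a haa (hJa j hj) heq
        have h4 := hρ.triangle (x j) (x a) y
        rw [hρ.symm y (x a)] at h4
        rw [heq] at h1 h3
        have h5 : D * (ρ (x j) y + ρ (x a) y) < D * (2 * (2 * D * (4 * D ^ 2 * t a))) :=
          mul_lt_mul_of_pos_left (by linarith) (by linarith)
        have h6 : D * (2 * (2 * D * (4 * D ^ 2 * t a))) = (4 * D ^ 2) ^ 2 * t a := by ring
        linarith
    have hup : ∀ i ∈ J, Function.update Q a P i = Q i := fun i hi => by simp [hJa i hi]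
    refine ⟨Function.update Q a P, ?_, ?_⟩
    · intro i hi j hj
      rcases Finset.mem_insert.1 hi with rfl | hi' <;> rcases Finset.mem_insert.1 hj with rfl | hj
      · exact Or.inl subset_rfl
      · rw [hup j hj, Function.update_self]
        exact Or.inr ((hdis j hj).imp id fun h => h.symm)
      · rw [hup i hi', Function.update_self]
        exact (hdis i hi').imp id Or.inr
      · rw [hup i hi', hup j hj]
        exact hlam i hi' j hj
    · intro i hi
      rcases Finset.mem_insert.1 hi with rfl | hi
      · rw [Function.update_self]
        exact ⟨(hb i haa).union (Finset.measurableSet_biUnion _ fun j hj => (hQ j (hFJ j hj)).1),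
          Set.subset_union_left, hPball⟩
      · rw [hup i hi]
        exact hQ i hi

/-- The constant comparing a sparse part of a ball with its dilation. -/
noncomputable def overlapConst (H D γ : ℝ) : ℝ := H ^ ⌈(4 * D ^ 2) ^ 4⌉₊ / γ


lemma iUnion_qball_eq_univ (x : X) {r : ℝ} (hr : 0 < r) :
    ⋃ n : ℕ, qball ρ x (n * r) = Set.univ := by
  refine Set.eq_univ_of_forall fun y => Set.mem_iUnion.2 ?_
  obtain ⟨n, hn⟩ := exists_nat_gt (ρ x y / r)
  exact ⟨n, (div_lt_iff₀ hr).1 hn⟩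

variable [MeasurableSpace X] {μ : Measure X}

lemma IsSpace.measure_qball_two_pow_le (hX : IsSpace ρ μ D H) (x : X) {r : ℝ} (hr : 0 < r)
    (n : ℕ) : μ (qball ρ x (2 ^ n * r)) ≤ ENNReal.ofReal H ^ n * μ (qball ρ x r) := by
  induction n with
  | zero => simp
  | succ n ih =>
    rw [pow_succ', mul_assoc, pow_succ', mul_assoc]
    exact (hX.doubling x _ (by positivity)).trans (by gcongr)

lemma IsSpace.exists_measure_qball_le (hX : IsSpace ρ μ D H) (x y : X) (r : ℝ) {s : ℝ}
    (hs : 0 < s) : ∃ n : ℕ, μ (qball ρ x r) ≤ ENNReal.ofReal H ^ n * μ (qball ρ y s) := by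
  obtain ⟨n, hn⟩ := pow_unbounded_of_one_lt (D * (ρ y x + r) / s) one_lt_two
  refine ⟨n, (measure_mono ?_).trans (hX.measure_qball_two_pow_le y hs n)⟩
  exact hX.quasimetric.qball_subset le_rfl ((div_le_iff₀ hs).1 hn.le)

/-- By doubling, one null ball makes all its dilates, hence X, null, and one ball of infinite
measure makes all balls infinite. In the latter case no point is a density point of X itself,
against the density condition. -/
lemma IsSpace.measure_qball_ne (hX : IsSpace ρ μ D H) (hd : DensityCondition μ (balls ρ))
    (hμ : μ ≠ 0) (x : X) {r : ℝ} (hr : 0 < r) :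
    μ (qball ρ x r) ≠ 0 ∧ μ (qball ρ x r) ≠ ∞ := by
  constructor
  · intro h0
    refine hμ (Measure.measure_univ_eq_zero.1 ?_)
    rw [← iUnion_qball_eq_univ (ρ := ρ) x hr, measure_iUnion_null_iff]
    intro n
    obtain ⟨k, hk⟩ := hX.exists_measure_qball_le x x (n * r) hr
    rw [h0, mul_zero] at hk
    exact le_antisymm hk zero_le
  · intro htop
    have hall : ∀ B ∈ balls ρ, μ B = ∞ := by
      rintro _ ⟨y, s, hs, rfl⟩
      obtain ⟨k, hk⟩ := hX.exists_measure_qball_le x y r hs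
      by_contra hne
      rw [htop, top_le_iff] at hk
      exact ENNReal.mul_ne_top (ENNReal.pow_ne_top ENNReal.ofReal_ne_top) hne hk
    have := hd Set.univ MeasurableSet.univ
    have hF : ∀ᵐ _ : X ∂μ, False := by
      filter_upwards [this] with y hy
      obtain ⟨B, hB, -, hlt⟩ := hy trivial (1 / 2) (by norm_num)
      rw [hall B hB, ENNReal.mul_top (by norm_num)] at hlt
      exact not_top_lt hlt
    exact hμ (by simpa using hF)

lemma IsSpace.one_le (hX : IsSpace ρ μ D H) (x : X) {r : ℝ} (hr : 0 < r)
    (h0 : μ (qball ρ x r) ≠ 0) (htop : μ (qball ρ x r) ≠ ∞) : 1 ≤ H := by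
  have h1 : μ (qball ρ x r) ≤ ENNReal.ofReal H * μ (qball ρ x r) :=
    (measure_mono (qball_mono x (by linarith))).trans (hX.doubling x r hr)
  rw [← ENNReal.one_le_ofReal, ← ENNReal.mul_le_mul_iff_left h0 htop, one_mul]
  exact h1

lemma overlapConst_pos (hH : 1 ≤ H) {γ : ℝ} (hγ : 0 < γ) : 0 < overlapConst H D γ := by
  have : 0 < H := by linarith
  unfold overlapConst
  positivity

/-- The large ball about y lies in a dilate of the ball about x, so doubling compares it with b and
sparseness with e. With y another center it bounds the coloring degree; with y = x it controls the
ball containing Q. -/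
lemma IsSpace.measure_qball_le_mul (hX : IsSpace ρ μ D H) (hH : 1 ≤ H) {γ : ℝ} (hγ : 0 < γ)
    {x y : X} {t : ℝ} (ht : 0 < t) (hxy : ρ y x < (4 * D ^ 2) ^ 2 * t) {b e : Set X}
    (hb : qball ρ x t ⊆ b) (he : ENNReal.ofReal γ * μ b ≤ μ e) :
    μ (qball ρ y ((4 * D ^ 2) ^ 3 * t)) ≤ ENNReal.ofReal (overlapConst H D γ) * μ e := by
  have hD := hX.quasimetric.one_lt
  set L := 4 * D ^ 2 with hL
  set n := ⌈L ^ 4⌉₊ with hn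
  have hL4 : 4 * D ≤ L := by nlinarith
  have hL1 : 1 ≤ L := by nlinarith
  -- The crude n ≤ 2^n is enough; the dilation factor needed is L⁴, from D(L² + L³) ≤ 2D L³ ≤ L⁴.
  have hpow : L ^ 4 ≤ 2 ^ n := by
    refine (Nat.le_ceil _).trans ?_
    exact_mod_cast Nat.lt_two_pow_self.le
  have hsub : qball ρ y (L ^ 3 * t) ⊆ qball ρ x (2 ^ n * t) := by
    refine hX.quasimetric.qball_subset (t := L ^ 2 * t) ?_ ?_
    · rw [hX.quasimetric.symm]; exact hxy.le
    · calc D * (L ^ 2 * t + L ^ 3 * t) ≤ D * (L ^ 3 * t + L ^ 3 * t) := by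
            have : L ^ 2 ≤ L ^ 3 := pow_le_pow_right₀ hL1 (by norm_num)
            have : 0 < D := by linarith
            gcongr
        _ = (2 * D) * (L ^ 3 * t) := by ring
        _ ≤ L * (L ^ 3 * t) := by gcongr; linarith
        _ = L ^ 4 * t := by ring
        _ ≤ 2 ^ n * t := by gcongr
  calc μ (qball ρ y (L ^ 3 * t)) ≤ μ (qball ρ x (2 ^ n * t)) := measure_mono hsub
    _ ≤ ENNReal.ofReal H ^ n * μ (qball ρ x t) := hX.measure_qball_two_pow_le x ht n
    _ ≤ ENNReal.ofReal H ^ n * μ b := by gcongr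
    _ = ENNReal.ofReal (overlapConst H D γ) * (ENNReal.ofReal γ * μ b) := by
        rw [← mul_assoc, ← ENNReal.ofReal_mul (overlapConst_pos hH hγ).le, overlapConst,
          div_mul_cancel₀ _ hγ.ne', ENNReal.ofReal_pow (by linarith)]
    _ ≤ _ := by gcongr

open Classical in
/-- A sparse family has boundedly many members of a given scale near each of its members. -/
lemma IsSpace.card_neighbors_le (hX : IsSpace ρ μ D H) (hH : 1 ≤ H) {γ : ℝ} (hγ : 0 < γ)
    (hball : ∀ (x : X) (r : ℝ), 0 < r → μ (qball ρ x r) ≠ 0 ∧ μ (qball ρ x r) ≠ ∞)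
    (J : Finset ι) (x : ι → X) (t : ι → ℝ) (b E : ι → Set X) (ht : ∀ i ∈ J, 0 < t i)
    (hxb : ∀ i ∈ J, qball ρ (x i) (t i) ⊆ b i)
    (hbx : ∀ i ∈ J, b i ⊆ qball ρ (x i) (4 * D ^ 2 * t i))
    (hE : ∀ i ∈ J, MeasurableSet (E i) ∧ E i ⊆ b i ∧ ENNReal.ofReal γ * μ (b i) ≤ μ (E i))
    (hdisj : Set.PairwiseDisjoint (J : Set ι) E) (i : ι) (hi : i ∈ J) :
    (J.filter fun j => t i = t j ∧ ρ (x i) (x j) < (4 * D ^ 2) ^ 2 * t i).card ≤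
      ⌊overlapConst H D γ⌋₊ := by
  have hD := hX.quasimetric.one_lt
  set F := J.filter fun j => t i = t j ∧ ρ (x i) (x j) < (4 * D ^ 2) ^ 2 * t i with hF
  set P := qball ρ (x i) ((4 * D ^ 2) ^ 3 * t i) with hP
  have hti := ht i hi
  have hFJ : ∀ j ∈ F, j ∈ J := fun j hj => Finset.mem_of_mem_filter j hj
  have h1 : ∀ j ∈ F, μ P ≤ ENNReal.ofReal (overlapConst H D γ) * μ (E j) := by
    intro j hj
    obtain ⟨hjJ, htt, hd⟩ := Finset.mem_filter.1 hj
    rw [hP, htt]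
    rw [htt] at hd
    exact hX.measure_qball_le_mul hH hγ (ht j hjJ) hd (hxb j hjJ) (hE j hjJ).2.2
  have h2 : ∀ j ∈ F, E j ⊆ P := by
    intro j hj
    obtain ⟨hjJ, htt, hd⟩ := Finset.mem_filter.1 hj
    refine (hE j hjJ).2.1.trans ((hbx j hjJ).trans ?_)
    refine hX.quasimetric.qball_subset hd.le ?_
    rw [← htt]
    have hL4 : 4 * D ≤ 4 * D ^ 2 := by nlinarith
    have hL1 : 1 ≤ 4 * D ^ 2 := by nlinarith
    set L := 4 * D ^ 2
    calc D * (L ^ 2 * t i + L * t i) ≤ D * (L ^ 2 * t i + L ^ 2 * t i) := by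
          have : L ≤ L ^ 2 := by nlinarith
          gcongr
      _ = (2 * D) * (L ^ 2 * t i) := by ring
      _ ≤ L * (L ^ 2 * t i) := by gcongr; linarith
      _ = L ^ 3 * t i := by ring
  have hPpos := hball (x i) ((4 * D ^ 2) ^ 3 * t i) (by positivity)
  -- Packing: the disjoint sets E j lie in P and each has at least the fraction 1/K of its measure.
  have h3 : (F.card : ℝ≥0∞) * μ P ≤ ENNReal.ofReal (overlapConst H D γ) * μ P := by
    calc (F.card : ℝ≥0∞) * μ P = ∑ j ∈ F, μ P := by simp
      _ ≤ ∑ j ∈ F, ENNReal.ofReal (overlapConst H D γ) * μ (E j) := Finset.sum_le_sum h1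
      _ = ENNReal.ofReal (overlapConst H D γ) * μ (⋃ j ∈ F, E j) := by
          rw [← Finset.mul_sum, measure_biUnion_finset
            (hdisj.subset fun j hj => hFJ j hj) fun j hj => (hE j (hFJ j hj)).1]
      _ ≤ _ := by
          gcongr
          exact Set.iUnion₂_subset h2
  rw [ENNReal.mul_le_mul_iff_left hPpos.1 hPpos.2] at h3
  apply Nat.le_floor
  rw [← ENNReal.ofReal_natCast] at h3
  exact (ENNReal.ofReal_le_ofReal_iff (overlapConst_pos hH hγ).le).1 h3

open Classical in
/-- A finite sparse family of balls splits into boundedly many subfamilies, each of which is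
dominated by a laminar family. -/
lemma IsSpace.exists_laminar_coloring (hX : IsSpace ρ μ D H) (hH : 1 ≤ H) {γ : ℝ} (hγ : 0 < γ)
    (hball : ∀ (x : X) (r : ℝ), 0 < r → μ (qball ρ x r) ≠ 0 ∧ μ (qball ρ x r) ≠ ∞)
    (J : Finset (Set X)) (hJ : ∀ B ∈ J, B ∈ balls ρ) (E : Set X → Set X)
    (hE : ∀ B ∈ J, MeasurableSet (E B) ∧ E B ⊆ B ∧ ENNReal.ofReal γ * μ B ≤ μ (E B))
    (hdisj : Set.PairwiseDisjoint (J : Set (Set X)) E) :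
    ∃ (col : Set X → ℕ) (Q : Set X → Set X), (∀ B ∈ J, col B < ⌊overlapConst H D γ⌋₊) ∧
      (∀ n, IsLaminar (J.filter fun B => col B = n) Q) ∧
      ∀ B ∈ J, MeasurableSet (Q B) ∧ B ⊆ Q B ∧
        ∃ P ∈ balls ρ, Q B ⊆ P ∧ μ P ≤ ENNReal.ofReal (overlapConst H D γ) * μ (E B) := by
  have hD := hX.quasimetric.one_lt
  have hL1 : 1 < 4 * D ^ 2 := by nlinarith
  rcases J.eq_empty_or_nonempty with rfl | ⟨B₀, hB₀⟩
  · exact ⟨fun _ => 0, fun _ => ∅, by simp, by simp [IsLaminar], by simp⟩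
  obtain ⟨x₀, -⟩ := hJ B₀ hB₀
  -- A ball need not determine its center and radius, so one choice is fixed, with the radius in
  -- [L^k, L^{k+1}). Sets outside J get dummy data.
  have hdata : ∀ B : Set X, ∃ (x : X) (k : ℤ), B ∈ J →
      qball ρ x ((4 * D ^ 2) ^ k) ⊆ B ∧ B ⊆ qball ρ x (4 * D ^ 2 * (4 * D ^ 2) ^ k) := by
    intro B
    by_cases hB : B ∈ J
    · obtain ⟨x, r, hr, rfl⟩ := hJ B hB
      obtain ⟨k, hk⟩ := exists_mem_Ico_zpow hr hL1
      refine ⟨x, k, fun _ => ⟨qball_mono x hk.1, qball_mono x ?_⟩⟩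
      rw [← zpow_one_add₀ (by positivity), add_comm]
      exact hk.2.le
    · exact ⟨x₀, 0, fun h => absurd h hB⟩
  choose x k hxk using hdata
  set t : Set X → ℝ := fun B => (4 * D ^ 2) ^ k B with ht_def
  have ht : ∀ B, 0 < t B := fun B => by positivity
  have hgap : ∀ B C, t B < t C → 4 * D ^ 2 * t B ≤ t C := by
    intro B C h
    have h1 : k B < k C := (zpow_lt_zpow_iff_right₀ hL1).1 h
    rw [ht_def, ← zpow_one_add₀ (by positivity)]
    exact zpow_le_zpow_right₀ hL1.le (by omega)
  set R : Set X → Set X → Prop :=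
    fun B C => t B = t C ∧ ρ (x B) (x C) < (4 * D ^ 2) ^ 2 * t B with hR
  obtain ⟨col, hcol, hne⟩ := exists_coloring R
    (fun B C h => ⟨h.1.symm, by rw [hX.quasimetric.symm, ← h.1]; exact h.2⟩)
    (fun B => ⟨rfl, by
      rw [(hX.quasimetric.eq_zero_iff _ _).2 rfl]
      have := ht B
      positivity⟩) _ J
    (fun B hB => hX.card_neighbors_le hH hγ hball J x t id E (fun B _ => ht B)
      (fun B hB => (hxk B hB).1) (fun B hB => (hxk B hB).2) hE hdisj B hB)
  have hlam := fun n : ℕ => exists_laminar hX.quasimetric (J.filter fun B => col B = n) x t id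
    (fun B _ => ht B)
    (fun B hB => hX.measurableSet_ball B (hJ B (Finset.mem_of_mem_filter B hB)))
    (fun B hB => (hxk B (Finset.mem_of_mem_filter B hB)).2)
    (fun B _ C _ => hgap B C)
    (fun B hB C hC hBC htt => by
      by_contra hlt
      obtain ⟨hB, hBn⟩ := Finset.mem_filter.1 hB
      obtain ⟨hC, hCn⟩ := Finset.mem_filter.1 hC
      exact hne B hB C hC hBC ⟨htt, not_le.1 hlt⟩ (hBn.trans hCn.symm))
  choose Q hQlam hQ using hlam
  refine ⟨col, fun B => Q (col B) B, hcol, ?_, ?_⟩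
  · intro n B hB C hC
    have := hQlam n B hB C hC
    simp only [(Finset.mem_filter.1 hB).2, (Finset.mem_filter.1 hC).2]
    exact this
  · intro B hB
    obtain ⟨h1, h2, h3⟩ := hQ (col B) B (Finset.mem_filter.2 ⟨hB, rfl⟩)
    have htB := ht B
    refine ⟨h1, h2, qball ρ (x B) ((4 * D ^ 2) ^ 3 * t B), ⟨_, _, by positivity, rfl⟩,
      h3.trans (qball_mono _ ?_), ?_⟩
    · have hL4 : 2 * D ≤ 4 * D ^ 2 := by nlinarith
      have hL1' := hL1.le
      set L := 4 * D ^ 2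
      calc 2 * D * (L * t B) ≤ L * (L * t B) := by gcongr
        _ = L ^ 2 * t B := by ring
        _ ≤ L ^ 3 * t B :=
          mul_le_mul_of_nonneg_right (pow_le_pow_right₀ hL1' (by norm_num)) htB.le
    · refine hX.measure_qball_le_mul hH hγ htB ?_ (hxk B hB).1 (hE B hB).2.2
      rw [(hX.quasimetric.eq_zero_iff _ _).2 rfl]
      positivity

end Geometry

/-! ### A_p weights and the dual weight -/

section Weights

variable {X : Type*} {p q : ℝ} {w : X → ℝ}

/-- The density of the dual weight. -/
noncomputable def dualDensity (p : ℝ) (w : X → ℝ) (x : X) : ℝ≥0∞ :=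
  ENNReal.ofReal (w x) ^ (-1 / (p - 1))

lemma dualDensity_ne_zero {x : X} (hx : 0 < w x) : dualDensity p w x ≠ 0 :=
  (ENNReal.rpow_pos (ENNReal.ofReal_pos.2 hx) ENNReal.ofReal_ne_top).ne'

lemma dualDensity_ne_top {x : X} (hx : 0 < w x) : dualDensity p w x ≠ ∞ :=
  ENNReal.rpow_ne_top_of_ne_zero (ENNReal.ofReal_pos.2 hx).ne' ENNReal.ofReal_ne_top

variable [MeasurableSpace X] {μ : Measure X}

/-- The measure given by the dual weight. -/
noncomputable def dualMeasure (μ : Measure X) (p : ℝ) (w : X → ℝ) : Measure X :=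
  μ.withDensity (dualDensity p w)

lemma measurable_dualDensity (hw : Measurable w) : Measurable (dualDensity p w) := by
  unfold dualDensity
  fun_prop

lemma absolutelyContinuous_weightedMeasure (hw : Measurable w) (hpos : ∀ᵐ x ∂μ, 0 < w x) :
    μ ≪ weightedMeasure μ w :=
  withDensity_absolutelyContinuous' (by fun_prop)
    (hpos.mono fun _ hx => (ENNReal.ofReal_pos.2 hx).ne')

lemma absolutelyContinuous_dualMeasure (hw : Measurable w) (hpos : ∀ᵐ x ∂μ, 0 < w x) :
    μ ≪ dualMeasure μ p w :=
  withDensity_absolutelyContinuous' (measurable_dualDensity hw).aemeasurable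
    (hpos.mono fun _ hx => dualDensity_ne_zero hx)

/-- Hölder's inequality applied to 1 = w^{1/p} σ^{1/q}. -/
lemma measure_le_weighted_mul_dual (hpq : p.HolderConjugate q) (hw : Measurable w)
    (hpos : ∀ᵐ x ∂μ, 0 < w x) {E : Set X} (hE : MeasurableSet E) :
    μ E ≤ weightedMeasure μ w E ^ (1 / p) * dualMeasure μ p w E ^ (1 / q) := by
  have hold := ENNReal.lintegral_mul_le_Lp_mul_Lq (μ.restrict E) hpq
    (f := fun x => ENNReal.ofReal (w x) ^ (1 / p)) (g := fun x => dualDensity p w x ^ (1 / q))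
    (by fun_prop) ((measurable_dualDensity hw).pow_const _).aemeasurable
  simp only [← ENNReal.rpow_mul, one_div_mul_cancel hpq.ne_zero,
    one_div_mul_cancel hpq.symm.ne_zero, ENNReal.rpow_one] at hold
  rw [weightedMeasure, dualMeasure, withDensity_apply _ hE, withDensity_apply _ hE]
  refine le_trans ?_ hold
  have : ∫⁻ _ in E, 1 ∂μ = ∫⁻ x in E, ((fun x => ENNReal.ofReal (w x) ^ (1 / p)) *
      fun x => dualDensity p w x ^ (1 / q)) x ∂μ := by
    refine lintegral_congr_ae (ae_restrict_of_ae ?_)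
    filter_upwards [hpos] with x hx
    simp only [Pi.mul_apply, dualDensity]
    have h1 := hpq.sub_one_ne_zero
    have h2 := hpq.ne_zero
    rw [← ENNReal.rpow_mul, ← ENNReal.rpow_add _ _ (ENNReal.ofReal_pos.2 hx).ne'
      ENNReal.ofReal_ne_top, hpq.conjugate_eq,
      show 1 / p + -1 / (p - 1) * (1 / (p / (p - 1))) = 0 by field_simp; ring, ENNReal.rpow_zero]
  rw [← this]
  simp

lemma setLIntegral_div_dualDensity (hw : Measurable w) (hpos : ∀ᵐ x ∂μ, 0 < w x)
    {F : X → ℝ≥0∞} (hF : Measurable F) {B : Set X} (hB : MeasurableSet B) :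
    ∫⁻ x in B, F x / dualDensity p w x ∂(dualMeasure μ p w) = ∫⁻ x in B, F x ∂μ := by
  have hd := measurable_dualDensity (p := p) hw
  have hFd : Measurable fun x => F x / dualDensity p w x := hF.div hd
  rw [dualMeasure, setLIntegral_withDensity_eq_setLIntegral_mul _ hd hFd hB]
  refine lintegral_congr_ae (ae_restrict_of_ae ?_)
  filter_upwards [hpos] with x hx
  exact ENNReal.mul_div_cancel (dualDensity_ne_zero hx) (dualDensity_ne_top hx)

/-- Because σ^{1-p} = w, the map F ↦ F/σ is an isometry from L^p(w) to L^p(σ). -/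
lemma lintegral_div_dualDensity_rpow (hp : 1 < p) (hw : Measurable w) (hpos : ∀ᵐ x ∂μ, 0 < w x)
    {F : X → ℝ≥0∞} (hF : Measurable F) :
    ∫⁻ x, (F x / dualDensity p w x) ^ p ∂(dualMeasure μ p w) =
      ∫⁻ x, F x ^ p ∂(weightedMeasure μ w) := by
  have hd := measurable_dualDensity (p := p) hw
  have hFd : Measurable fun x => F x / dualDensity p w x := hF.div hd
  have hp1 : p - 1 ≠ 0 := by linarith
  rw [dualMeasure, weightedMeasure,
    lintegral_withDensity_eq_lintegral_mul _ hd (hFd.pow_const _),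
    lintegral_withDensity_eq_lintegral_mul _ (by fun_prop) (hF.pow_const _)]
  refine lintegral_congr_ae ?_
  filter_upwards [hpos] with x hx
  simp only [Pi.mul_apply]
  have h0 := dualDensity_ne_zero (p := p) hx
  have ht := dualDensity_ne_top (p := p) hx
  have hW : dualDensity p w x ^ (1 - p) = ENNReal.ofReal (w x) := by
    rw [dualDensity, ← ENNReal.rpow_mul, show -1 / (p - 1) * (1 - p) = 1 by field_simp; ring,
      ENNReal.rpow_one]
  rw [ENNReal.div_rpow_of_nonneg _ _ (by linarith), ← hW, ENNReal.rpow_sub _ _ h0 ht,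
    ENNReal.rpow_one, ENNReal.div_eq_inv_mul, ENNReal.div_eq_inv_mul]
  ring

lemma weighted_mul_dual_le_apCharacteristic (hpq : p.HolderConjugate q) {𝓑 : Set (Set X)}
    {B : Set X} (hB : B ∈ 𝓑) (hBm : MeasurableSet B) (h0 : μ B ≠ 0) (htop : μ B ≠ ∞) :
    weightedMeasure μ w B * dualMeasure μ p w B ^ (p - 1) ≤ apCharacteristic μ 𝓑 p w * μ B ^ p := by
  have hp1 := hpq.sub_one_pos
  have hle : (⨍⁻ x in B, ENNReal.ofReal (w x) ∂μ) *
      (⨍⁻ x in B, ENNReal.ofReal (w x) ^ (-1 / (p - 1)) ∂μ) ^ (p - 1) ≤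
        apCharacteristic μ 𝓑 p w :=
    le_iSup₂ (f := fun B _ => (⨍⁻ x in B, ENNReal.ofReal (w x) ∂μ) *
      (⨍⁻ x in B, ENNReal.ofReal (w x) ^ (-1 / (p - 1)) ∂μ) ^ (p - 1)) B hB
  rw [setLAverage_eq, setLAverage_eq] at hle
  rw [weightedMeasure, dualMeasure, withDensity_apply _ hBm, withDensity_apply _ hBm]
  simp only [dualDensity]
  set a := ∫⁻ x in B, ENNReal.ofReal (w x) ∂μ
  set b := ∫⁻ x in B, ENNReal.ofReal (w x) ^ (-1 / (p - 1)) ∂μ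
  calc a * b ^ (p - 1) = (a / μ B * μ B) * (b / μ B * μ B) ^ (p - 1) := by
        rw [ENNReal.div_mul_cancel h0 htop, ENNReal.div_mul_cancel h0 htop]
    _ = (a / μ B * (b / μ B) ^ (p - 1)) * (μ B ^ (1 : ℝ) * μ B ^ (p - 1)) := by
        rw [ENNReal.mul_rpow_of_nonneg _ _ hp1.le, ENNReal.rpow_one]
        ring
    _ = (a / μ B * (b / μ B) ^ (p - 1)) * μ B ^ p := by
        rw [← ENNReal.rpow_add _ _ h0 htop]
        congr 2; ring
    _ ≤ _ := by gcongr

/-- The product ω(B) ν(B)^{p-1} is finite by the A_p condition, and neither factor vanishes since w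
> 0 a.e., so neither can be infinite. -/
lemma weighted_ne_top_and_dual_ne_top (hpq : p.HolderConjugate q) {𝓑 : Set (Set X)}
    (hw : Measurable w) (hpos : ∀ᵐ x ∂μ, 0 < w x) (hA : apCharacteristic μ 𝓑 p w < ∞)
    {B : Set X} (hB : B ∈ 𝓑) (hBm : MeasurableSet B) (h0 : μ B ≠ 0) (htop : μ B ≠ ∞) :
    weightedMeasure μ w B ≠ ∞ ∧ dualMeasure μ p w B ≠ ∞ := by
  have hp1 := hpq.sub_one_pos
  have hlt : weightedMeasure μ w B * dualMeasure μ p w B ^ (p - 1) ≠ ∞ :=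
    ne_top_of_le_ne_top
      (ENNReal.mul_ne_top hA.ne (ENNReal.rpow_ne_top_of_nonneg hpq.nonneg htop))
      (weighted_mul_dual_le_apCharacteristic hpq hB hBm h0 htop)
  have hω0 : weightedMeasure μ w B ≠ 0 := fun h =>
    h0 (absolutelyContinuous_weightedMeasure hw hpos h)
  have hν0 : dualMeasure μ p w B ≠ 0 := fun h =>
    h0 (absolutelyContinuous_dualMeasure hw hpos h)
  constructor
  · intro h
    rw [h, ENNReal.top_mul] at hlt
    · exact hlt rfl
    · simp [hν0, hp1, not_lt.2 hp1.le]
  · intro h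
    rw [h, ENNReal.top_rpow_of_pos hp1, ENNReal.mul_top hω0] at hlt
    exact hlt rfl

end Weights

/-! ### The sparse operator -/

section Sparse

variable {X : Type*} [MeasurableSpace X] {ρ : X → X → ℝ} {μ : Measure X} {D H γ p q : ℝ}
  {w : X → ℝ}

/-- The constant in the bound of the sparse operator. -/
noncomputable def sparseConst (H D γ p q : ℝ) : ℝ≥0∞ :=
  ⌊overlapConst H D γ⌋₊ *
    (ENNReal.ofReal (overlapConst H D γ) ^ max p q * (ENNReal.ofReal p * ENNReal.ofReal q))

lemma IsSpace.sum_bilinear_le (hX : IsSpace ρ μ D H) (hH : 1 ≤ H) (hγ : 0 < γ)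
    (hball : ∀ (x : X) (r : ℝ), 0 < r → μ (qball ρ x r) ≠ 0 ∧ μ (qball ρ x r) ≠ ∞)
    (J : Finset (Set X)) (hJ : ∀ B ∈ J, B ∈ balls ρ) (E : Set X → Set X)
    (hE : ∀ B ∈ J, MeasurableSet (E B) ∧ E B ⊆ B ∧ ENNReal.ofReal γ * μ B ≤ μ (E B))
    (hdisj : Set.PairwiseDisjoint (J : Set (Set X)) E)
    (hpq : p.HolderConjugate q) (hw : Measurable w) (hpos : ∀ᵐ x ∂μ, 0 < w x)
    (hA : apCharacteristic μ (balls ρ) p w < ∞)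
    {F g : X → ℝ≥0∞} (hF : Measurable F) (hg : Measurable g) :
    ∑ B ∈ J, (μ B)⁻¹ * ((∫⁻ x in B, F x ∂μ) * ∫⁻ x in B, g x ∂(weightedMeasure μ w)) ≤
      sparseConst H D γ p q * apCharacteristic μ (balls ρ) p w ^ max 1 (1 / (p - 1)) *
        ((∫⁻ x, F x ^ p ∂(weightedMeasure μ w)) ^ (1 / p) *
          (∫⁻ x, g x ^ q ∂(weightedMeasure μ w)) ^ (1 / q)) := by
  classical
  obtain ⟨col, Q, hcol, hlam, hQ⟩ := hX.exists_laminar_coloring hH hγ hball J hJ E hE hdisj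
  have hballs : ∀ B ∈ balls ρ, MeasurableSet B ∧ μ B ≠ 0 ∧ μ B ≠ ∞ := by
    rintro B ⟨x, r, hr, rfl⟩
    exact ⟨hX.measurableSet_ball _ ⟨x, r, hr, rfl⟩, hball x r hr⟩
  set ω := weightedMeasure μ w with hω
  set ν := dualMeasure μ p w with hν
  set A := apCharacteristic μ (balls ρ) p w with hA_def
  set h : X → ℝ≥0∞ := fun x => F x / dualDensity p w x with hh
  have hhm : Measurable h := hF.div (measurable_dualDensity hw)
  have hμQ : ∀ B ∈ J, μ (Q B) ≠ 0 := fun B hB h0 =>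
    (hballs B (hJ B hB)).2.1 (measure_mono_null (hQ B hB).2.1 h0)
  have hE0 : ∀ B ∈ J, μ (E B) ≠ 0 := fun B hB h0 => by
    have := (hE B hB).2.2
    rw [h0, nonpos_iff_eq_zero, mul_eq_zero] at this
    rcases this with h1 | h1
    · exact (ENNReal.ofReal_pos.2 hγ).ne' h1
    · exact (hballs B (hJ B hB)).2.1 h1
  have hEtop : ∀ B ∈ J, μ (E B) ≠ ∞ := fun B hB =>
    ne_top_of_le_ne_top (hballs B (hJ B hB)).2.2 (measure_mono (hE B hB).2.1)
  have hfin : ∀ B ∈ J, ω (Q B) ≠ ∞ ∧ ν (Q B) ≠ ∞ := by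
    intro B hB
    obtain ⟨P, hP, hQP, -⟩ := (hQ B hB).2.2
    obtain ⟨hPm, hP0, hPt⟩ := hballs P hP
    have := weighted_ne_top_and_dual_ne_top hpq hw hpos hA hP hPm hP0 hPt
    exact ⟨ne_top_of_le_ne_top this.1 (measure_mono hQP),
      ne_top_of_le_ne_top this.2 (measure_mono hQP)⟩
  have hAQ : ∀ B ∈ J, ω (Q B) * ν (Q B) ^ (p - 1) ≤
      A * (ENNReal.ofReal (overlapConst H D γ) * μ (E B)) ^ p := by
    intro B hB
    obtain ⟨P, hP, hQP, hPE⟩ := (hQ B hB).2.2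
    obtain ⟨hPm, hP0, hPt⟩ := hballs P hP
    have hp := hpq.nonneg
    have hp1 := hpq.sub_one_pos.le
    calc ω (Q B) * ν (Q B) ^ (p - 1) ≤ ω P * ν P ^ (p - 1) := by gcongr
      _ ≤ A * μ P ^ p := weighted_mul_dual_le_apCharacteristic hpq hP hPm hP0 hPt
      _ ≤ _ := by gcongr
  have hcolor : ∀ n : ℕ, ∑ B ∈ J.filter (fun B => col B = n),
      (μ B)⁻¹ * ((∫⁻ x in B, F x ∂μ) * ∫⁻ x in B, g x ∂ω) ≤
        A ^ max 1 (1 / (p - 1)) * ENNReal.ofReal (overlapConst H D γ) ^ max p q *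
          (ENNReal.ofReal p * ENNReal.ofReal q) *
          ((∫⁻ x, F x ^ p ∂ω) ^ (1 / p) * (∫⁻ x, g x ^ q ∂ω) ^ (1 / q)) := by
    intro n
    have hsub : ∀ B ∈ J.filter (fun B => col B = n), B ∈ J := fun B hB =>
      Finset.mem_of_mem_filter B hB
    -- The normalizing mass is μ(E B), not μ(B) or μ(Q B): Hölder bounds it by the weighted measures
    -- of E B, and the A_p bound on P costs only the factor K. As E B ⊆ B ⊆ Q B, passing to it only
    -- enlarges the form.
    have key := (hlam n).sum_bilinear_le_max ν ω hpq h g hhm hg Q E (fun B => μ (E B)) A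
      (ENNReal.ofReal (overlapConst H D γ)) _ (fun B hB => (hQ B (hsub B hB)).1)
      (fun B hB => (hE B (hsub B hB)).1)
      (fun B hB => (hE B (hsub B hB)).2.1.trans (hQ B (hsub B hB)).2.1)
      (hdisj.subset fun B hB => hsub B hB)
      (fun B hB h0 => hμQ B (hsub B hB) (absolutelyContinuous_dualMeasure hw hpos h0))
      (fun B hB => (hfin B (hsub B hB)).2)
      (fun B hB h0 => hμQ B (hsub B hB) (absolutelyContinuous_weightedMeasure hw hpos h0))
      (fun B hB => (hfin B (hsub B hB)).1)
      (fun B hB => hE0 B (hsub B hB)) (fun B hB => hEtop B (hsub B hB))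
      (fun B hB => hAQ B (hsub B hB))
      (fun B hB => measure_le_weighted_mul_dual hpq hw hpos (hE B (hsub B hB)).1)
    rw [lintegral_div_dualDensity_rpow hpq.lt hw hpos hF] at key
    refine le_trans (Finset.sum_le_sum fun B hB => ?_) key
    have hBJ := hsub B hB
    rw [setLIntegral_div_dualDensity hw hpos hF (hQ B hBJ).1]
    have := (hQ B hBJ).2.1
    have := (hE B hBJ).2.1
    gcongr
  calc ∑ B ∈ J, (μ B)⁻¹ * ((∫⁻ x in B, F x ∂μ) * ∫⁻ x in B, g x ∂ω)
      = ∑ n ∈ Finset.range ⌊overlapConst H D γ⌋₊, ∑ B ∈ J.filter (fun B => col B = n),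
          (μ B)⁻¹ * ((∫⁻ x in B, F x ∂μ) * ∫⁻ x in B, g x ∂ω) :=
        (Finset.sum_fiberwise_of_maps_to (fun B hB => Finset.mem_range.2 (hcol B hB)) _).symm
    _ ≤ _ := Finset.sum_le_sum fun n _ => hcolor n
    _ = _ := by
        rw [Finset.sum_const, Finset.card_range, nsmul_eq_mul, sparseConst]
        ring

/-- Test the bilinear form with g = T^{p-1}: the form becomes ∫ T^p dω, and so does ∫ g^q dω, so a
power of it can be absorbed. -/
lemma IsSpace.lintegral_sum_rpow_le (hX : IsSpace ρ μ D H) (hH : 1 ≤ H) (hγ : 0 < γ)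
    (hball : ∀ (x : X) (r : ℝ), 0 < r → μ (qball ρ x r) ≠ 0 ∧ μ (qball ρ x r) ≠ ∞)
    (J : Finset (Set X)) (hJ : ∀ B ∈ J, B ∈ balls ρ) (E : Set X → Set X)
    (hE : ∀ B ∈ J, MeasurableSet (E B) ∧ E B ⊆ B ∧ ENNReal.ofReal γ * μ B ≤ μ (E B))
    (hdisj : Set.PairwiseDisjoint (J : Set (Set X)) E)
    (hpq : p.HolderConjugate q) (hw : Measurable w) (hpos : ∀ᵐ x ∂μ, 0 < w x)
    (hA : apCharacteristic μ (balls ρ) p w < ∞)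
    {F : X → ℝ≥0∞} (hF : Measurable F) (hFp : ∫⁻ x, F x ^ p ∂(weightedMeasure μ w) ≠ ∞) :
    ∫⁻ x, (∑ B ∈ J, B.indicator (fun _ => ⨍⁻ y in B, F y ∂μ) x) ^ p ∂(weightedMeasure μ w) ≤
      (sparseConst H D γ p q * apCharacteristic μ (balls ρ) p w ^ max 1 (1 / (p - 1)) *
        (∫⁻ x, F x ^ p ∂(weightedMeasure μ w)) ^ (1 / p)) ^ p := by
  have hp := hpq.pos
  have hballs : ∀ B ∈ J, MeasurableSet B ∧ μ B ≠ 0 ∧ μ B ≠ ∞ := by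
    intro B hB
    obtain ⟨x, r, hr, rfl⟩ := hJ B hB
    exact ⟨hX.measurableSet_ball _ ⟨x, r, hr, rfl⟩, hball x r hr⟩
  have hfin : ∀ B ∈ J, weightedMeasure μ w B ≠ ∞ ∧ dualMeasure μ p w B ≠ ∞ := fun B hB =>
    weighted_ne_top_and_dual_ne_top hpq hw hpos hA (hJ B hB) (hballs B hB).1 (hballs B hB).2.1
      (hballs B hB).2.2
  set ω := weightedMeasure μ w with hω
  set a : Set X → ℝ≥0∞ := fun B => ⨍⁻ y in B, F y ∂μ with ha
  set T : X → ℝ≥0∞ := fun x => ∑ B ∈ J, B.indicator (fun _ => a B) x with hT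
  have hTm : Measurable T :=
    Finset.measurable_fun_sum _ fun B hB => measurable_const.indicator (hballs B hB).1
  have hafin : ∀ B ∈ J, a B ≠ ∞ := by
    intro B hB
    have hd := measurable_dualDensity (p := p) hw
    have h1 := ENNReal.lintegral_mul_le_Lp_mul_Lq ((dualMeasure μ p w).restrict B) hpq
      (hF.div hd).aemeasurable (g := fun _ => 1) (by fun_prop)
    simp only [Pi.mul_apply, Pi.div_apply, mul_one, ENNReal.one_rpow, lintegral_const, one_mul,
      Measure.restrict_apply_univ] at h1
    rw [setLIntegral_div_dualDensity hw hpos hF (hballs B hB).1] at h1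
    rw [ha]
    simp only [setLAverage_eq]
    refine ENNReal.div_ne_top (ne_top_of_le_ne_top (ENNReal.mul_ne_top ?_ ?_) h1)
      (hballs B hB).2.1
    · refine ENNReal.rpow_ne_top_of_nonneg hpq.one_div_nonneg
        (ne_top_of_le_ne_top hFp ?_)
      rw [← lintegral_div_dualDensity_rpow hpq.lt hw hpos hF]
      exact setLIntegral_le_lintegral _ _
    · exact ENNReal.rpow_ne_top_of_nonneg hpq.symm.one_div_nonneg (hfin B hB).2
  -- Finiteness for the absorption: T is bounded by the finite sum of the averages and vanishes off
  -- a set of finite ω-measure.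
  have hTfin : ∫⁻ x, T x ^ p ∂ω ≠ ∞ := by
    have hle : ∀ x, T x ^ p ≤ (⋃ B ∈ J, B).indicator (fun _ => (∑ B ∈ J, a B) ^ p) x := by
      intro x
      by_cases hx : x ∈ ⋃ B ∈ J, B
      · rw [Set.indicator_of_mem hx]
        refine ENNReal.rpow_le_rpow (Finset.sum_le_sum fun B _ => ?_) hp.le
        exact Set.indicator_le_self' (fun _ _ => zero_le) x
      · have : T x = 0 := Finset.sum_eq_zero fun B hB =>
          Set.indicator_of_notMem (fun h => hx (Set.mem_biUnion hB h)) _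
        rw [this, ENNReal.zero_rpow_of_pos hp]
        exact zero_le
    refine ne_top_of_le_ne_top ?_ (lintegral_mono hle)
    rw [lintegral_indicator_const (Finset.measurableSet_biUnion _ fun B hB => (hballs B hB).1)]
    refine ENNReal.mul_ne_top (ENNReal.rpow_ne_top_of_nonneg hp.le ?_) ?_
    · exact ENNReal.sum_ne_top.2 hafin
    · exact (measure_biUnion_lt_top J.finite_toSet fun B hB => (hfin B hB).1.lt_top).ne
  refine le_rpow_of_le_mul_rpow hpq hTfin ?_
  have hg : Measurable fun x => T x ^ (p - 1) := hTm.pow_const _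
  have key := hX.sum_bilinear_le hH hγ hball J hJ E hE hdisj hpq hw hpos hA hF hg
  simp only [← ENNReal.rpow_mul, hpq.sub_one_mul_conj] at key
  rw [mul_assoc]
  refine le_trans (le_of_eq ?_) key
  calc ∫⁻ x, T x ^ p ∂ω
      = ∫⁻ x, ∑ B ∈ J, B.indicator (fun x => a B * T x ^ (p - 1)) x ∂ω := by
        refine lintegral_congr fun x => ?_
        have h1 : T x ^ p = T x * T x ^ (p - 1) := by
          conv_rhs => rw [← ENNReal.rpow_one (T x), ← ENNReal.rpow_mul, one_mul]
          rw [← ENNReal.rpow_add_of_nonneg _ _ zero_le_one hpq.sub_one_pos.le, add_sub_cancel]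
        rw [h1, show T x = ∑ B ∈ J, B.indicator (fun _ => a B) x from rfl, Finset.sum_mul]
        refine Finset.sum_congr rfl fun B _ => ?_
        by_cases hx : x ∈ B <;> simp [hx, T]
    _ = ∑ B ∈ J, a B * ∫⁻ x in B, T x ^ (p - 1) ∂ω := by
        rw [lintegral_finsetSum' _ fun B hB =>
          ((hg.const_mul (a B)).indicator (hballs B hB).1).aemeasurable]
        refine Finset.sum_congr rfl fun B hB => ?_
        rw [lintegral_indicator (hballs B hB).1, lintegral_const_mul _ hg]
    _ = _ := by
        refine Finset.sum_congr rfl fun B _ => ?_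
        rw [ha]
        simp only [setLAverage_eq, ENNReal.div_eq_inv_mul, mul_assoc, hω]

lemma sigmaFinite_of_measure_qball_ne_top
    (hball : ∀ (x : X) (r : ℝ), 0 < r → μ (qball ρ x r) ≠ ∞) : SigmaFinite μ := by
  rcases isEmpty_or_nonempty X with h | ⟨⟨x⟩⟩
  · rw [Measure.eq_zero_of_isEmpty μ]
    infer_instance
  · refine ⟨⟨⟨fun n : ℕ => qball ρ x (n * 1), fun _ => trivial, fun n => ?_,
      iUnion_qball_eq_univ x one_pos⟩⟩⟩
    refine (measure_mono (qball_mono x (s := n + 1) (by simp))).trans_lt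
      (hball x (n + 1) (by positivity)).lt_top

lemma IsSpace.eLpNorm_sparseOperator_le (hX : IsSpace ρ μ D H) (hH : 1 ≤ H) (hγ : 0 < γ)
    (hball : ∀ (x : X) (r : ℝ), 0 < r → μ (qball ρ x r) ≠ 0 ∧ μ (qball ρ x r) ≠ ∞)
    {S : Set (Set X)} (hS : S ⊆ balls ρ) (hsp : IsSparse μ γ S)
    (hpq : p.HolderConjugate q) (hw : Measurable w) (hpos : ∀ᵐ x ∂μ, 0 < w x)
    (hA : apCharacteristic μ (balls ρ) p w < ∞)
    {f : X → ℝ} (hf : MemLp f (ENNReal.ofReal p) (weightedMeasure μ w)) :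
    eLpNorm (sparseOperator μ S f) (ENNReal.ofReal p) (weightedMeasure μ w) ≤
      sparseConst H D γ p q * apCharacteristic μ (balls ρ) p w ^ max 1 (1 / (p - 1)) *
        eLpNorm f (ENNReal.ofReal p) (weightedMeasure μ w) := by
  have hp := hpq.pos
  obtain ⟨E, hE, hdisj⟩ := hsp
  have hσ := sigmaFinite_of_measure_qball_ne_top (ρ := ρ) fun x r hr => (hball x r hr).2
  -- The sets E B are disjoint and of positive measure in a σ-finite space. Countability is what
  -- permits monotone convergence over the finite subfamilies.
  have hcount : Countable S := by
    have h1 := Measure.countable_meas_pos_of_disjoint_iUnion (μ := μ)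
      (As := fun B : S => E B) (fun B => (hE B B.2).1)
      fun B C hBC => hdisj B.2 C.2 fun h => hBC (Subtype.ext h)
    refine Set.countable_univ_iff.1 (h1.mono fun B _ => ?_)
    obtain ⟨x, r, hr, hB⟩ := hS B.2
    refine lt_of_lt_of_le ?_ (hE B B.2).2.2
    rw [hB]
    exact ENNReal.mul_pos (ENNReal.ofReal_pos.2 hγ).ne' (hball x r hr).1
  set F : X → ℝ≥0∞ := fun x => ‖hf.1.mk f x‖ₑ with hF
  have hFm : Measurable F := hf.1.stronglyMeasurable_mk.measurable.enorm
  have hFω : (fun x => ‖f x‖ₑ) =ᵐ[weightedMeasure μ w] F := by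
    filter_upwards [hf.1.ae_eq_mk] with x hx
    rw [hF, hx]
  have hFμ : (fun x => ‖f x‖ₑ) =ᵐ[μ] F :=
    (absolutelyContinuous_weightedMeasure hw hpos).ae_le hFω
  have hpe0 : ENNReal.ofReal p ≠ 0 := (ENNReal.ofReal_pos.2 hp).ne'
  have hfF : eLpNorm f (ENNReal.ofReal p) (weightedMeasure μ w) =
      (∫⁻ x, F x ^ p ∂(weightedMeasure μ w)) ^ (1 / p) := by
    rw [eLpNorm_eq_lintegral_rpow_enorm_toReal hpe0 ENNReal.ofReal_ne_top,
      ENNReal.toReal_ofReal hp.le]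
    congr 1
    refine lintegral_congr_ae (hFω.mono fun x hx => ?_)
    simp only at hx
    simp only [hx]
  have hFp : ∫⁻ x, F x ^ p ∂(weightedMeasure μ w) ≠ ∞ := by
    intro h
    rw [h, ENNReal.top_rpow_of_pos (by positivity)] at hfF
    exact hf.2.ne hfF
  have hop : sparseOperator μ S f = fun x => ⨆ s : Finset S,
      ∑ B ∈ s, (B : Set X).indicator (fun _ => ⨍⁻ y in (B : Set X), F y ∂μ) x := by
    funext x
    rw [sparseOperator, ENNReal.tsum_eq_iSup_sum]
    congr 1
    funext s
    refine Finset.sum_congr rfl fun B _ => ?_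
    congr 1
    funext _
    exact laverage_congr (ae_restrict_of_ae hFμ)
  rw [hfF, eLpNorm_eq_lintegral_rpow_enorm_toReal hpe0 ENNReal.ofReal_ne_top,
    ENNReal.toReal_ofReal hp.le, hop]
  simp only [enorm_eq_self]
  rw [one_div, ENNReal.rpow_inv_le_iff hp]
  have hpow : ∀ x, (⨆ s : Finset S, ∑ B ∈ s, (B : Set X).indicator
      (fun _ => ⨍⁻ y in (B : Set X), F y ∂μ) x) ^ p = ⨆ s : Finset S, (∑ B ∈ s,
        (B : Set X).indicator (fun _ => ⨍⁻ y in (B : Set X), F y ∂μ) x) ^ p := fun x =>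
    (ENNReal.orderIsoRpow p hp).map_iSup _
  simp only [hpow]
  rw [lintegral_iSup_directed]
  · refine iSup_le fun s => ?_
    have key := hX.lintegral_sum_rpow_le hH hγ hball (s.map ⟨Subtype.val, Subtype.val_injective⟩)
      (fun B hB => ?_) E (fun B hB => ?_) (hdisj.subset fun B hB => ?_) hpq hw hpos hA hFm hFp
    · simpa only [Finset.sum_map, Function.Embedding.coeFn_mk, one_div] using key
    all_goals
      simp only [Finset.coe_map, Function.Embedding.coeFn_mk, Set.mem_image, Finset.mem_map] at hB
      obtain ⟨B, -, rfl⟩ := hB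
    · exact hS B.2
    · exact hE B B.2
    · exact B.2
  · intro s
    refine ((Finset.measurable_fun_sum _ fun B _ => ?_).pow_const _).aemeasurable
    exact measurable_const.indicator (hX.measurableSet_ball _ (hS B.2))
  · refine Monotone.directed_le fun s t hst x => ?_
    exact ENNReal.rpow_le_rpow (Finset.sum_le_sum_of_subset hst) hp.le

/-- The part of the constant determined by the geometry. -/
noncomputable def geometricConst (H D γ : ℝ) : ℝ :=
  (⌊overlapConst H D γ⌋₊ + 1) * Real.exp (Real.log (overlapConst H D γ) ^ 2)

/-- The part of the constant determined by the exponent. -/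
noncomputable def exponentConst (p : ℝ) : ℝ :=
  Real.exp (max p p.conjExponent ^ 2) * (|p| * |p.conjExponent| + 1)

/-- The factor K^{max(p,q)} mixes geometry and exponent; log K · m ≤ (log K)² + m² separates them.
The absolute values and the added ones keep both constants positive for all parameters. -/
lemma sparseConst_le (hH : 1 ≤ H) (hγ : 0 < γ) (hp : 1 < p) :
    sparseConst H D γ p p.conjExponent ≤
      ENNReal.ofReal (geometricConst H D γ * exponentConst p) := by
  have hpq := Real.HolderConjugate.conjExponent hp
  set q := p.conjExponent with hq
  set K := overlapConst H D γ with hK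
  have hK0 : 0 < K := overlapConst_pos hH hγ
  have hp0 := hpq.pos
  have hq0 := hpq.symm.pos
  rw [sparseConst, ENNReal.ofReal_rpow_of_pos hK0, ← ENNReal.ofReal_mul hp0.le,
    ← ENNReal.ofReal_mul (by positivity), ← ENNReal.ofReal_natCast,
    ← ENNReal.ofReal_mul (by positivity)]
  refine ENNReal.ofReal_le_ofReal ?_
  have hexp : K ^ max p q ≤ Real.exp (Real.log K ^ 2) * Real.exp (max p q ^ 2) := by
    rw [Real.rpow_def_of_pos hK0, ← Real.exp_add]
    refine Real.exp_le_exp.2 ?_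
    nlinarith [sq_nonneg (Real.log K - max p q), sq_nonneg (Real.log K), sq_nonneg (max p q)]
  rw [geometricConst, exponentConst, ← hq, ← hK, abs_of_pos hp0, abs_of_pos hq0]
  calc (⌊K⌋₊ : ℝ) * (K ^ max p q * (p * q))
      ≤ (⌊K⌋₊ + 1) * ((Real.exp (Real.log K ^ 2) * Real.exp (max p q ^ 2)) * (p * q + 1)) := by
        gcongr <;> linarith
    _ = _ := by ring

end Sparse

end HomogeneousType

/-- `c` gives the constant depending on the doubling constant `H`, the quasimetric constant `D`
and the sparseness constant `γ`, and `cp` the one depending on `p` only. -/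
theorem mainTheorem7 :
    ∃ (c : ℝ → ℝ → ℝ → ℝ) (cp : ℝ → ℝ),
      (∀ H D γ, 0 < c H D γ) ∧ (∀ p, 0 < cp p) ∧
      ∀ (X : Type*) [MeasurableSpace X] (ρ : X → X → ℝ) (μ : Measure X) (D H : ℝ)
        (_ : HomogeneousType.IsSpace ρ μ D H)
        (_ : HomogeneousType.DensityCondition μ (HomogeneousType.balls ρ))
        (γ : ℝ) (_ : 0 < γ) (_ : γ < 1)
        (S : Set (Set X)) (_ : S ⊆ HomogeneousType.balls ρ)
        (_ : HomogeneousType.IsSparse μ γ S)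
        (p : ℝ) (_ : 1 < p)
        (w : X → ℝ) (_ : Measurable w) (_ : ∀ᵐ x ∂μ, 0 < w x)
        (_ : HomogeneousType.apCharacteristic μ (HomogeneousType.balls ρ) p w < ∞),
        HomogeneousType.lpOperatorNorm (HomogeneousType.weightedMeasure μ w) p
            (HomogeneousType.sparseOperator μ S) ≤
          ENNReal.ofReal (c H D γ * cp p) *
            HomogeneousType.apCharacteristic μ (HomogeneousType.balls ρ) p w ^
              max 1 (1 / (p - 1)) := by
  refine ⟨HomogeneousType.geometricConst, HomogeneousType.exponentConst, ?_, ?_, ?_⟩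
  · intro H D γ
    unfold HomogeneousType.geometricConst
    positivity
  · intro p
    unfold HomogeneousType.exponentConst
    positivity
  intro X _ ρ μ D H hX hd γ hγ _ S hS hsp p hp w hw hpos hA
  refine iSup₂_le fun f hf => ?_
  -- For μ = 0 balls are null and the geometry is void, but every quotient is 0 / 0 = 0.
  rcases eq_or_ne μ 0 with rfl | hμ
  · simp [HomogeneousType.weightedMeasure]
  have hball := fun (x : X) (r : ℝ) (hr : 0 < r) => hX.measure_qball_ne hd hμ x hr
  obtain ⟨x⟩ : Nonempty X := by
    by_contra h
    rw [not_nonempty_iff] at h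
    exact hμ (Measure.eq_zero_of_isEmpty μ)
  have hH := hX.one_le x one_pos (hball x 1 one_pos).1 (hball x 1 one_pos).2
  refine ENNReal.div_le_of_le_mul ?_
  refine (hX.eLpNorm_sparseOperator_le hH hγ hball hS hsp
    (Real.HolderConjugate.conjExponent hp) hw hpos hA hf).trans ?_
  gcongr
  exact HomogeneousType.sparseConst_le hH hγ hp
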